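/- Let $X$ be a complex manifold of dimension $n$ with a Hermitian metric, and let $g$ be the induced Riemannian metric on $X$. Let $V\subset X$ be a complex submanifold of dimension $k$ (embedded, not necessarily closed), and let $h(x)=\big(\inf_{y\in V}\delta(x,y)\big)^2$, where $\delta$ is the Riemannian distance of $g$. Then for every $p\in V$ there is a holomorphic coordinate chart $(U,z=(z_1,\dots,z_n))$ centered at $p$ (that is, $p\in U$ and $z(p)=0$) such that $U\cap V=\{z_{k+1}=\dots=z_n=0\}$, the function $h$ is of class $C^2$ near $p$, and $$\frac{\partial^2 h}{\partial z_i\,\partial\bar z_j}(0)=\begin{cases}0 & \text{if } i\le k \text{ or } j\le k,\\ 2\delta_{ij} & \text{if } i,j>k,\end{cases}\qquad 1\le i,j\le n.$$ -/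

import Mathlib

open scoped Manifold ContDiff ENNReal Bundle

noncomputable section

/-- The model space `ℂⁿ` of complex `n`-dimensional manifolds. -/
abbrev Cn (n : ℕ) : Type := EuclideanSpace ℂ (Fin n)

/-- The real smooth (indeed real analytic) structure underlying a complex manifold. -/
instance isManifold_real_of_complex {n : ℕ} {X : Type*} [TopologicalSpace X]
    [ChartedSpace (Cn n) X] [IsManifold 𝓘(ℂ, Cn n) ω X] : IsManifold 𝓘(ℝ, Cn n) ω X := by
  apply isManifold_of_contDiffOn
  intro e e' he he'
  have h := (contDiffGroupoid ω 𝓘(ℂ, Cn n)).compatible he he'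
  rw [contDiffGroupoid, mem_groupoid_of_pregroupoid] at h
  exact h.1.restrict_scalars ℝ

/-- A Hermitian metric on the complex manifold `X`: a smooth Riemannian metric `g` on the
underlying real manifold which is invariant under the complex structure `J v = i • v` of the
tangent spaces. (A tangent space is the model space `ℂⁿ`, read in the preferred holomorphic
chart at the point, so that `J` is the multiplication by `i`. The fundamental form of the metric
is `(v, w) ↦ g (J v) w`, and `g` is the Riemannian metric induced by it.) -/
structure HermitianMetric (n : ℕ) (X : Type*) [TopologicalSpace X]
    [ChartedSpace (Cn n) X] [IsManifold 𝓘(ℂ, Cn n) ω X] extends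
    Bundle.ContMDiffRiemannianMetric 𝓘(ℝ, Cn n) ∞ (Cn n)
      (fun x : X ↦ TangentSpace 𝓘(ℝ, Cn n) x) where
  inner_J : ∀ (x : X) (v w : Cn n),
    inner x (Complex.I • v : Cn n) (Complex.I • w : Cn n) = inner x v w

/-- The Riemannian distance of the metric `g`: the infimum of the `g`-lengths of `C¹` paths from
`x` to `y` (it is `∞` between different connected components). -/
def HermitianMetric.riemDist {n : ℕ} {X : Type*} [TopologicalSpace X]
    [ChartedSpace (Cn n) X] [IsManifold 𝓘(ℂ, Cn n) ω X] (g : HermitianMetric n X)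
    (x y : X) : ℝ≥0∞ :=
  letI : Bundle.RiemannianBundle (fun x : X ↦ TangentSpace 𝓘(ℝ, Cn n) x) :=
    ⟨g.toContMDiffRiemannianMetric.toRiemannianMetric⟩
  Manifold.riemannianEDist 𝓘(ℝ, Cn n) x y

/-- The function `h`, the square of the Riemannian distance to `V`. (The infimum is taken in
`[0, ∞]`, so components of `X` or of `V` at infinite distance do no harm.) -/
def HermitianMetric.sqDist {n : ℕ} {X : Type*} [TopologicalSpace X]
    [ChartedSpace (Cn n) X] [IsManifold 𝓘(ℂ, Cn n) ω X] (g : HermitianMetric n X)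
    (V : Set X) (x : X) : ℝ :=
  (⨅ y ∈ V, g.riemDist x y).toReal ^ 2

/-- In the chart `z` of `X`, with domain `U`, one has `U ∩ V = {z_{k+1} = ⋯ = z_n = 0}`
(the coordinates are indexed from `0` in the code, so the last `n - k` ones are those with
index `≥ k`). -/
def IsSliceChart {n : ℕ} {X : Type*} [TopologicalSpace X]
    (k : ℕ) (V : Set X) (z : OpenPartialHomeomorph X (Cn n)) : Prop :=
  z.source ∩ V = {x ∈ z.source | ∀ i : Fin n, k ≤ (i : ℕ) → z x i = 0}

/-- `V` is an (embedded, not necessarily closed) complex submanifold of `X`, of complex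
dimension `k`: around each of its points there is a holomorphic chart of `X` in which `V` is a
`k`-dimensional coordinate plane. -/
def IsComplexSubmanifold (n : ℕ) {X : Type*} [TopologicalSpace X]
    [ChartedSpace (Cn n) X] [IsManifold 𝓘(ℂ, Cn n) ω X] (k : ℕ) (V : Set X) : Prop :=
  k ≤ n ∧ ∀ p ∈ V, ∃ z ∈ IsManifold.maximalAtlas 𝓘(ℂ, Cn n) ω X,
    p ∈ z.source ∧ IsSliceChart k V z

/-- The Wirtinger derivative `∂F/∂z_i = (∂F/∂x_i - √-1 ∂F/∂y_i) / 2`, where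
`z_i = x_i + √-1 y_i`. -/
def wirtingerD {n : ℕ} (i : Fin n) (F : Cn n → ℂ) (z : Cn n) : ℂ :=
  (1 / 2) * (fderiv ℝ F z (EuclideanSpace.single i 1)
    - Complex.I * fderiv ℝ F z (EuclideanSpace.single i Complex.I))

/-- The Wirtinger derivative `∂F/∂z̄_j = (∂F/∂x_j + √-1 ∂F/∂y_j) / 2`. -/
def wirtingerDBar {n : ℕ} (j : Fin n) (F : Cn n → ℂ) (z : Cn n) : ℂ :=
  (1 / 2) * (fderiv ℝ F z (EuclideanSpace.single j 1)
    + Complex.I * fderiv ℝ F z (EuclideanSpace.single j Complex.I))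

/-- The entry `∂²f / ∂z_i ∂z̄_j` of the complex Hessian of a real function `f` at `z`. -/
def complexHessian {n : ℕ} (f : Cn n → ℝ) (z : Cn n) (i j : Fin n) : ℂ :=
  wirtingerD i (wirtingerDBar j (fun w ↦ (f w : ℂ))) z

end

/-!
Near `p`, the function `h` is identified with the energy of normal geodesics. In a slice chart
centered at `p` the submanifold is the kernel of a linear projection `P`, orthogonal at `0` for the
metric `G` in the chart. A geodesic, as a solution of the Hamiltonian system of
`H(x, q) = |q|² / 2` on `E × E*`, is normal to `ker P` exactly when its initial point `x` lies in
`ker P` and its initial momentum vanishes on `ker P`. These initial data form a linear space `L(E)`,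
parametrized by `L η = (η - P η, G₀ (P η))`.

*Regularity.* The unknown is the pair of `η` and of a continuous map `u : [0, 1] → E × E*`, and the
equations are `u = L η + ∫ X_H(u)` and `u(1) = (ξ, _)`. The composition operator with a `C¹` map is
`C¹` for the sup norm, the linearization at the zero solution is explicitly invertible (the
linearization of `X_H` at `0` has square zero), so one application of the inverse function theorem
in a Banach space gives a normal geodesic which is a `C¹` function of its end point `ξ`
(`exists_contDiffAt_boundary_solution`); no flow of an ordinary differential equation is needed. Let
`f ξ = 2 H` along this geodesic. The final momentum is a `C¹` function of `ξ`, and it is half of `df` by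
the first variation formula (`hasFDerivAt_energy`), so `f` is of class `C²`, and its Hessian at `0` is
`2 G₀(P ·, ·)` (`exists_sqDist_potential`).

*Identification.* The normal geodesic ending at `ξ` has constant speed `√(f ξ)`, so `h ≤ f`.
Conversely `|df|² ≤ 4 f` in the metric, which says that `√f` is `1`-Lipschitz, and `f = 0` on `V`, so
a path from `ξ` to `V` which stays in the chart has length at least `√(f ξ)`; a path which leaves the
chart is longer than that if `ξ` is close to `0` (`HermitianMetric.sqrt_le_riemDist`). Hence `h = f`
near `p` (`HermitianMetric.exists_hasFDerivAt_sqDist`).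

*Normalization.* Gram-Schmidt, for the Hermitian inner product with real part `G₀ / 2`, gives a
triangular linear change of coordinates, hence one which respects the slice, after which `G₀` is
twice the standard scalar product and `P` the projection to the last coordinates
(`exists_linear_normalization`). Then `h` is `2 ∑_{i ≥ k} |z_i|²` up to `o(|z|²)`, which gives the
complex Hessian (`complexHessian_eq`).
-/

noncomputable section
open scoped Manifold ContDiff ENNReal Bundle Topology ComplexConjugate
open Filter MeasureTheory
set_option maxSynthPendingDepth 3

/-! ### Composition operators and primitives on spaces of continuous maps -/

section Nemytskii
variable {K F F' L : Type*} [TopologicalSpace K] [CompactSpace K]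
  [NormedAddCommGroup F] [NormedSpace ℝ F] [NormedAddCommGroup F'] [NormedSpace ℝ F']
  [NormedAddCommGroup L] [NormedSpace ℝ L]

/-- The pointwise application `(A, v) ↦ (t ↦ β (A t) (v t))` of a continuous bilinear map `β`, as a
continuous bilinear map on spaces of continuous maps with the sup norm. -/
def ContinuousMap.pointwiseBilin (β : L →L[ℝ] F →L[ℝ] F') :
    C(K, L) →L[ℝ] C(K, F) →L[ℝ] C(K, F') :=
  LinearMap.mkContinuous₂
    (LinearMap.mk₂ ℝ (fun (A : C(K, L)) (v : C(K, F)) ↦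
        (⟨fun t ↦ β (A t) (v t), (β.continuous.comp A.continuous).clm_apply v.continuous⟩ :
          C(K, F')))
      (by intros; ext; simp) (by intros; ext; simp) (by intros; ext; simp) (by intros; ext; simp))
    ‖β‖ (by
      intro A v
      refine (ContinuousMap.norm_le _ (by positivity)).2 fun t ↦ ?_
      refine (β.le_opNorm₂ _ _).trans ?_
      gcongr
      exacts [A.norm_coe_le_norm t, v.norm_coe_le_norm t])

/-- The composition operator `u ↦ φ ∘ u` on continuous maps on a compact space. -/
abbrev ContinuousMap.postcompOp (φ : F → F') (hφ : Continuous φ) (u : C(K, F)) : C(K, F') :=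
  (⟨φ, hφ⟩ : C(F, F')).comp u

/-- The derivative of the composition operator `u ↦ φ ∘ u`. The derivative of `φ` is presented
as `β ∘ φ'`, with `φ'` valued in an arbitrary normed space. -/
lemma hasFDerivAt_postcompOp_bilin {φ : F → F'} (hφ : Continuous φ) {φ' : F → L}
    (hφ' : Continuous φ') {β : L →L[ℝ] F →L[ℝ] F'} (h : ∀ x, HasFDerivAt φ (β (φ' x)) x)
    (u : C(K, F)) :
    HasFDerivAt (ContinuousMap.postcompOp φ hφ)
      (ContinuousMap.pointwiseBilin β (ContinuousMap.postcompOp φ' hφ' u)) u := by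
  rw [hasFDerivAt_iff_isLittleO_nhds_zero, Asymptotics.isLittleO_iff]
  intro ε hε
  have hβ : 0 < ‖β‖ + 1 := by positivity
  have hc : Continuous (fun u : C(K, F) ↦ ContinuousMap.postcompOp φ' hφ' u) :=
    ContinuousMap.continuous_postcomp _
  obtain ⟨δ, hδ, hball⟩ := Metric.continuousAt_iff.1 (hc.continuousAt (x := u)) (ε / (‖β‖ + 1))
    (by positivity)
  filter_upwards [Metric.ball_mem_nhds 0 hδ] with v hv
  refine (ContinuousMap.norm_le _ (by positivity)).2 fun t ↦ ?_
  have hv' : ‖v‖ < δ := by simpa using hv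
  have key : ∀ x ∈ segment ℝ (u t) (u t + v t), ‖β (φ' x) - β (φ' (u t))‖ ≤ ε := by
    intro x hx
    rw [segment_eq_image_lineMap] at hx
    obtain ⟨s, hs, rfl⟩ := hx
    have h1 : dist (u + s • v) u < δ := by
      rw [dist_eq_norm, add_sub_cancel_left, norm_smul, Real.norm_of_nonneg hs.1]
      exact (mul_le_of_le_one_left (norm_nonneg _) hs.2).trans_lt hv'
    have h2 := (ContinuousMap.dist_le (by positivity)).1 (hball h1).le t
    rw [dist_eq_norm] at h2
    have h3 : AffineMap.lineMap (u t) (u t + v t) s = (u + s • v) t := by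
      simp [AffineMap.lineMap_apply, add_comm]
    rw [h3, ← map_sub]
    refine (β.le_opNorm _).trans ?_
    calc ‖β‖ * ‖φ' ((u + s • v) t) - φ' (u t)‖ ≤ ‖β‖ * (ε / (‖β‖ + 1)) := by gcongr; exact h2
      _ ≤ (‖β‖ + 1) * (ε / (‖β‖ + 1)) := by gcongr; linarith
      _ = ε := by field_simp
  have := (convex_segment (u t) (u t + v t)).norm_image_sub_le_of_norm_hasFDerivWithin_le'
    (f := φ) (φ := β (φ' (u t))) (f' := fun x ↦ β (φ' x))
    (fun x _ ↦ (h x).hasFDerivWithinAt) key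
    (left_mem_segment ℝ _ _) (right_mem_segment ℝ _ _)
  rw [add_sub_cancel_left] at this
  exact this.trans (mul_le_mul_of_nonneg_left (v.norm_coe_le_norm t) hε.le)

lemma contDiff_postcompOp_bilin {φ : F → F'} (hφ : Continuous φ) {φ' : F → L}
    (hφ' : Continuous φ') {β : L →L[ℝ] F →L[ℝ] F'} (h : ∀ x, HasFDerivAt φ (β (φ' x)) x) :
    ContDiff ℝ 1 (ContinuousMap.postcompOp (K := K) φ hφ) := by
  rw [contDiff_one_iff_fderiv]
  refine ⟨fun u ↦ (hasFDerivAt_postcompOp_bilin hφ hφ' h u).differentiableAt, ?_⟩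
  rw [funext fun u ↦ (hasFDerivAt_postcompOp_bilin hφ hφ' h u).fderiv]
  exact (ContinuousLinearMap.continuous _).comp (ContinuousMap.continuous_postcomp _)

lemma exists_hasFDerivAt_postcompOp {φ : F → F'} (hφ : ContDiff ℝ 1 φ) (u : C(K, F)) :
    ∃ D : C(K, F) →L[ℝ] C(K, F'),
      HasFDerivAt (ContinuousMap.postcompOp φ hφ.continuous) D u ∧
        ∀ v t, D v t = fderiv ℝ φ (u t) (v t) :=
  ⟨_, hasFDerivAt_postcompOp_bilin hφ.continuous (hφ.continuous_fderiv one_ne_zero)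
    (β := ContinuousLinearMap.id ℝ (F →L[ℝ] F'))
    (fun x ↦ (hφ.differentiable one_ne_zero x).hasFDerivAt) u, fun _ _ ↦ rfl⟩

lemma contDiff_postcompOp {φ : F → F'} (hφ : ContDiff ℝ 1 φ) :
    ContDiff ℝ 1 (ContinuousMap.postcompOp (K := K) φ hφ.continuous) :=
  contDiff_postcompOp_bilin hφ.continuous (hφ.continuous_fderiv one_ne_zero)
    (β := ContinuousLinearMap.id ℝ (F →L[ℝ] F'))
    (fun x ↦ (hφ.differentiable one_ne_zero x).hasFDerivAt)

end Nemytskii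

section Primitive
variable {F : Type*} [NormedAddCommGroup F]

/-- A continuous map on `[0, 1]`, extended to `ℝ` by constants. -/
abbrev extendUnit (u : C(unitInterval, F)) : ℝ → F := Set.IccExtend zero_le_one u

lemma continuous_extendUnit (u : C(unitInterval, F)) : Continuous (extendUnit u) :=
  u.continuous.Icc_extend'

variable [NormedSpace ℝ F]

/-- The primitive operator `u ↦ (t ↦ ∫₀ᵗ u)` on continuous maps on `[0, 1]`. -/
def primitiveUnit : C(unitInterval, F) →L[ℝ] C(unitInterval, F) :=
  LinearMap.mkContinuous
    { toFun := fun u ↦ ⟨fun t ↦ ∫ s in (0 : ℝ)..t, extendUnit u s,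
        (intervalIntegral.continuous_primitive
          (fun a b ↦ (continuous_extendUnit u).intervalIntegrable a b) 0).comp
          continuous_subtype_val⟩
      map_add' := fun u v ↦ by
        ext t
        simp only [ContinuousMap.coe_mk, ContinuousMap.add_apply]
        rw [← intervalIntegral.integral_add
          ((continuous_extendUnit u).intervalIntegrable _ _)
          ((continuous_extendUnit v).intervalIntegrable _ _)]
        rfl
      map_smul' := fun c u ↦ by
        ext t
        simp only [ContinuousMap.coe_mk, ContinuousMap.smul_apply, RingHom.id_apply]
        rw [← intervalIntegral.integral_smul]
        rfl }
    1 (by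
      intro u
      rw [one_mul]
      refine (ContinuousMap.norm_le _ (norm_nonneg _)).2 fun t ↦ ?_
      refine (intervalIntegral.norm_integral_le_of_norm_le_const (C := ‖u‖)
        fun s _ ↦ u.norm_coe_le_norm _).trans ?_
      rw [sub_zero, abs_of_nonneg t.2.1]
      exact mul_le_of_le_one_right (norm_nonneg _) t.2.2)

lemma primitiveUnit_apply (u : C(unitInterval, F)) (t : unitInterval) :
    primitiveUnit u t = ∫ s in (0 : ℝ)..t, extendUnit u s := rfl

lemma primitiveUnit_zero_right (u : C(unitInterval, F)) : primitiveUnit u 0 = 0 := by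
  simp [primitiveUnit_apply]

variable [CompleteSpace F]

/-- A constant operator commutes with taking primitives. -/
lemma primitiveUnit_comp {F' : Type*} [NormedAddCommGroup F'] [NormedSpace ℝ F']
    [CompleteSpace F'] (A : F →L[ℝ] F') (u : C(unitInterval, F)) (t : unitInterval) :
    primitiveUnit ((A : C(F, F')).comp u) t = A (primitiveUnit u t) := by
  rw [primitiveUnit_apply, primitiveUnit_apply, ← ContinuousLinearMap.intervalIntegral_comp_comm _
    ((continuous_extendUnit u).intervalIntegrable _ _)]
  rfl

lemma hasDerivAt_integral_extendUnit (u : C(unitInterval, F)) (c : F) (t : ℝ) :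
    HasDerivAt (fun t ↦ c + ∫ s in (0 : ℝ)..t, extendUnit u s) (extendUnit u t) t := by
  have := intervalIntegral.integral_hasDerivAt_right
    ((continuous_extendUnit u).intervalIntegrable 0 t)
    (continuous_extendUnit u).aestronglyMeasurable.stronglyMeasurableAtFilter
    (continuous_extendUnit u).continuousAt
  exact this.const_add c

end Primitive

/-! ### A two-point boundary value problem -/

/-- Composition with a continuous linear map, on the left. -/
lemma ContinuousLinearMap.hasFDerivAt_comp {E F F' : Type*} [NormedAddCommGroup E]
    [NormedSpace ℝ E] [NormedAddCommGroup F] [NormedSpace ℝ F] [NormedAddCommGroup F']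
    [NormedSpace ℝ F'] (A : F →L[ℝ] F') {f : E → F} {f' : E →L[ℝ] F} {x : E}
    (h : HasFDerivAt f f' x) : HasFDerivAt (fun x ↦ A (f x)) (A.comp f') x :=
  A.hasFDerivAt.comp x h

section BoundaryProblem
variable {E F : Type*} [NormedAddCommGroup E] [NormedSpace ℝ E] [CompleteSpace E]
  [NormedAddCommGroup F] [NormedSpace ℝ F]

/-- The inclusion of the constants in the continuous maps on `[0, 1]`. -/
def constUnit : F →L[ℝ] C(unitInterval, F) :=
  LinearMap.mkContinuous
    { toFun := fun c ↦ ContinuousMap.const _ c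
      map_add' := fun _ _ ↦ rfl
      map_smul' := fun _ _ ↦ rfl }
    1 (by
      intro c
      rw [one_mul]
      exact (ContinuousMap.norm_le _ (norm_nonneg _)).2 fun t ↦ le_rfl)

@[simp] lemma constUnit_apply (c : F) (t : unitInterval) : constUnit c t = c := rfl

variable [CompleteSpace F]

lemma primitiveUnit_constUnit (c : F) (t : unitInterval) :
    primitiveUnit (constUnit c) t = (t : ℝ) • c := by
  rw [primitiveUnit_apply]
  have : extendUnit (constUnit c) = fun _ ↦ c := rfl
  rw [this, intervalIntegral.integral_const, sub_zero]

/-- The two-point problem `u' = X(u)`, `u(0) ∈ range L`, `ρ(u(1)) = ξ`, near a zero of `X` at which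
the linearization of `X` has square zero. The solution exists, is locally unique and is a
`C¹` function of `ξ`, with values in the continuous maps on `[0, 1]`. -/
theorem exists_contDiffAt_boundary_solution {X : F → F} (hX : ContDiff ℝ 1 X) (hX0 : X 0 = 0)
    (hA : ∀ v, fderiv ℝ X 0 (fderiv ℝ X 0 v) = 0) (L : E →L[ℝ] F) (ρ : F →L[ℝ] E)
    (hρ : ∀ η, ρ (L η + fderiv ℝ X 0 (L η)) = η) :
    ∃ S : E → E × C(unitInterval, F), S 0 = 0 ∧ ContDiffAt ℝ 1 S 0 ∧
      (∀ᶠ ξ in 𝓝 0, ρ ((S ξ).2 1) = ξ ∧ (S ξ).2 =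
        constUnit (L (S ξ).1) +
          primitiveUnit (ContinuousMap.postcompOp X hX.continuous (S ξ).2)) ∧
      (∀ᶠ q : E × C(unitInterval, F) in 𝓝 0, q.2 = constUnit (L q.1) +
          primitiveUnit (ContinuousMap.postcompOp X hX.continuous q.2) → S (ρ (q.2 1)) = q) ∧
      ∀ ξ, (fderiv ℝ S 0 ξ).2 1 = L ξ + fderiv ℝ X 0 (L ξ) := by
  set A := fderiv ℝ X 0 with hAdef
  obtain ⟨N', hN', hN'v⟩ := exists_hasFDerivAt_postcompOp hX (0 : C(unitInterval, F))
  have hN'A : ∀ v, N' v = (A : C(F, F)).comp v := fun v ↦ by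
    ext t; rw [hN'v]; rfl
  set Θ : E × C(unitInterval, F) → E × C(unitInterval, F) := fun q ↦
    (ρ (q.2 1), q.2 - constUnit (L q.1) -
      primitiveUnit (ContinuousMap.postcompOp X hX.continuous q.2)) with hΘ
  set ev : C(unitInterval, F) →L[ℝ] F := ContinuousMap.evalCLM ℝ 1
  have hev : ∀ u, ev u = u 1 := fun _ ↦ rfl
  set p₁ := ContinuousLinearMap.fst ℝ E C(unitInterval, F)
  set p₂ := ContinuousLinearMap.snd ℝ E C(unitInterval, F)
  have hΘC : ContDiff ℝ 1 Θ := by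
    have h1 : ContDiff ℝ 1 (fun q : E × C(unitInterval, F) ↦ ρ (q.2 1)) :=
      ((ρ.comp ev).comp p₂).contDiff
    have h3 : ContDiff ℝ 1 (fun q : E × C(unitInterval, F) ↦
        (constUnit (L q.1) : C(unitInterval, F))) := ((constUnit.comp L).comp p₁).contDiff
    exact h1.prodMk ((contDiff_snd.sub h3).sub
      (primitiveUnit.contDiff.comp ((contDiff_postcompOp hX).comp contDiff_snd)))
  set D : E × C(unitInterval, F) →L[ℝ] E × C(unitInterval, F) :=
    ((ρ.comp ev).comp p₂).prod
      (p₂ - (constUnit.comp L).comp p₁ - (primitiveUnit.comp N').comp p₂) with hD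
  have hDapp : ∀ q, D q = (ρ (q.2 1), q.2 - constUnit (L q.1) -
      primitiveUnit ((A : C(F, F)).comp q.2)) := fun q ↦ by
    rw [← hN'A]; rfl
  have hΘD : HasFDerivAt Θ D 0 := by
    have h1 : HasFDerivAt (fun q : E × C(unitInterval, F) ↦ q.2) p₂ 0 := p₂.hasFDerivAt
    have h2 : HasFDerivAt (fun q : E × C(unitInterval, F) ↦ ρ (q.2 1)) ((ρ.comp ev).comp p₂) 0 :=
      ((ρ.comp ev).comp p₂).hasFDerivAt
    have h3 : HasFDerivAt (fun q : E × C(unitInterval, F) ↦ (constUnit (L q.1) :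
        C(unitInterval, F))) ((constUnit.comp L).comp p₁) 0 :=
      ((constUnit.comp L).comp p₁).hasFDerivAt
    have h4 : HasFDerivAt
        (fun u ↦ primitiveUnit (ContinuousMap.postcompOp X hX.continuous u))
        (primitiveUnit.comp N') 0 :=
      primitiveUnit.hasFDerivAt_comp hN'
    have h5 : HasFDerivAt (fun q : E × C(unitInterval, F) ↦
        primitiveUnit (ContinuousMap.postcompOp X hX.continuous q.2))
        ((primitiveUnit.comp N').comp p₂) 0 :=
      HasFDerivAt.comp (g := fun u ↦ primitiveUnit (ContinuousMap.postcompOp X hX.continuous u))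
        (0 : E × C(unitInterval, F)) h4 h1
    exact h2.prodMk ((h1.sub h3).sub h5)
  -- `A` commutes with the primitive operator `J` and has square zero, so `A J A = 0`: this is what
  -- makes the equation `v = w + J A v` explicitly solvable, with `A v = A w`
  have hAJA : ∀ v : C(unitInterval, F), ∀ t,
      A (primitiveUnit ((A : C(F, F)).comp v) t) = 0 := fun v t ↦ by
    rw [← primitiveUnit_comp]
    have : (A : C(F, F)).comp ((A : C(F, F)).comp v) = 0 := by
      ext s; exact hA _
    rw [this, map_zero]; rfl
  have hJ1 : ∀ c : F, primitiveUnit (constUnit c) 1 = c := fun c ↦ by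
    rw [primitiveUnit_constUnit]; simp
  have hAconst : ∀ c : F, (A : C(F, F)).comp (constUnit c) = constUnit (A c) := fun c ↦ rfl
  have hAadd : ∀ u v : C(unitInterval, F),
      (A : C(F, F)).comp (u + v) = (A : C(F, F)).comp u + (A : C(F, F)).comp v := fun u v ↦ by
    ext t; simp
  have hAJA' : ∀ v : C(unitInterval, F),
      (A : C(F, F)).comp (primitiveUnit ((A : C(F, F)).comp v)) = 0 := fun v ↦ by
    ext t; exact hAJA v t
  have hinj : Function.Injective D := by
    rw [injective_iff_map_eq_zero]
    rintro ⟨η, v⟩ h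
    rw [hDapp, Prod.mk_eq_zero] at h
    obtain ⟨h1, h2⟩ := h
    simp only at h1 h2
    have h3 : v = constUnit (L η) + primitiveUnit ((A : C(F, F)).comp v) := by
      rw [← sub_eq_zero, ← h2]; abel
    have h4 : (A : C(F, F)).comp v = constUnit (A (L η)) := by
      conv_lhs => rw [h3]
      rw [hAadd, hAJA', hAconst, add_zero]
    rw [h4] at h3
    have h5 : v 1 = L η + A (L η) := by
      rw [h3, ContinuousMap.add_apply, hJ1, constUnit_apply]
    have h6 : η = 0 := by rw [← hρ η, ← h5, h1]
    subst h6
    rw [h3]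
    simp
  have hsurj : Function.Surjective D := by
    rintro ⟨ξ, w⟩
    set η := ξ - ρ (w 1 + primitiveUnit ((A : C(F, F)).comp w) 1) with hη
    refine ⟨(η, w + constUnit (L η) + primitiveUnit ((A : C(F, F)).comp (w + constUnit (L η)))),
      ?_⟩
    rw [hDapp]
    simp only [hAadd, hAconst, map_add, ContinuousMap.add_apply, hJ1, constUnit_apply]
    ext1
    · have := hρ η
      rw [map_add] at this
      have h8 : η = ξ - (ρ (w 1) + ρ (primitiveUnit ((A : C(F, F)).comp w) 1)) := by
        rw [hη, map_add]
      simp only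
      calc _ = (ρ (w 1) + ρ (primitiveUnit ((A : C(F, F)).comp w) 1)) +
          (ρ (L η) + ρ (A (L η))) := by abel
        _ = ξ := by rw [this, h8]; abel
    · have e1 : (A : C(F, F)).comp (primitiveUnit (constUnit (A (L η)))) = 0 := by
        rw [← hAconst, hAJA']
      simp only [hAJA', e1, add_zero, map_zero]
      abel
  set De : (E × C(unitInterval, F)) ≃L[ℝ] (E × C(unitInterval, F)) :=
    ContinuousLinearEquiv.ofBijective D (LinearMap.ker_eq_bot.2 hinj)
      (LinearMap.range_eq_top.2 hsurj) with hDe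
  have hDe' : HasFDerivAt Θ (De : _ →L[ℝ] _) (0 : E × C(unitInterval, F)) := by
    convert! hΘD
  have hΘ0 : Θ 0 = 0 := by
    have : ContinuousMap.postcompOp X hX.continuous (0 : C(unitInterval, F)) = 0 := by
      ext t; exact hX0
    simp only [hΘ, Prod.snd_zero, Prod.fst_zero, map_zero, this, ContinuousMap.zero_apply,
      sub_self]
    rfl
  have hs := hΘC.contDiffAt.hasStrictFDerivAt' hDe' one_ne_zero
  set Φ := hΘC.contDiffAt.localInverse hDe' one_ne_zero with hΦ
  have hΦC : ContDiffAt ℝ 1 Φ 0 := by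
    have := hΘC.contDiffAt.to_localInverse hDe' one_ne_zero
    rwa [hΘ0] at this
  have hΦ0 : Φ 0 = 0 := by
    have := hΘC.contDiffAt.localInverse_apply_image hDe' one_ne_zero
    rwa [hΘ0] at this
  have hΦr : ∀ᶠ y in 𝓝 0, Θ (Φ y) = y := by
    have := hs.eventually_right_inverse
    rwa [hΘ0] at this
  have hΦl : ∀ᶠ q in 𝓝 0, Φ (Θ q) = q := hs.eventually_left_inverse
  have hΦD : HasFDerivAt Φ (De.symm : _ →L[ℝ] _) (0 : E × C(unitInterval, F)) := by
    have := hs.to_localInverse.hasFDerivAt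
    rwa [hΘ0] at this
  set ι := ContinuousLinearMap.inl ℝ E C(unitInterval, F)
  have hι0 : Tendsto ι (𝓝 0) (𝓝 0) := by
    simpa using ι.continuous.tendsto 0
  refine ⟨fun ξ ↦ Φ (ι ξ), by simp [hΦ0], ?_, ?_, ?_, ?_⟩
  · have : ContDiffAt ℝ 1 Φ (ι 0) := by simpa using hΦC
    exact this.comp 0 ι.contDiff.contDiffAt
  · filter_upwards [hι0.eventually hΦr] with ξ hξ
    have h1 := congrArg Prod.fst hξ
    have h2 := congrArg Prod.snd hξ
    simp only [hΘ, ι, ContinuousLinearMap.inl_apply] at h1 h2 ⊢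
    refine ⟨h1, ?_⟩
    rw [← sub_eq_zero, ← sub_sub, h2]
  · filter_upwards [hΦl] with q hq hu
    have : Θ q = ι (ρ (q.2 1)) := by
      simp only [hΘ, ι, ContinuousLinearMap.inl_apply]
      congr 1
      rw [sub_sub, sub_eq_zero]
      exact hu
    rw [← this, hq]
  · intro ξ
    have h1 : HasFDerivAt (fun ξ ↦ Φ (ι ξ)) ((De.symm : _ →L[ℝ] _).comp ι) 0 := by
      have : HasFDerivAt Φ (De.symm : _ →L[ℝ] _) (ι 0) := by simpa using hΦD
      exact this.comp 0 ι.hasFDerivAt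
    rw [h1.fderiv]
    have h2 : De (ξ, constUnit (L ξ) + primitiveUnit (constUnit (A (L ξ)))) = ι ξ := by
      have e1 : (A : C(F, F)).comp (primitiveUnit (constUnit (A (L ξ)))) = 0 := by
        rw [← hAconst, hAJA']
      change D _ = _
      rw [hDapp]
      simp only [hAadd, hAconst, e1, add_zero, ContinuousMap.add_apply, hJ1, constUnit_apply, hρ,
        ι, ContinuousLinearMap.inl_apply]
      congr 1
      abel
    have h3 : De.symm (ι ξ) = (ξ, constUnit (L ξ) + primitiveUnit (constUnit (A (L ξ)))) := by
      rw [← h2, De.symm_apply_apply]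
    change (De.symm (ι ξ)).2 1 = _
    rw [h3, ContinuousMap.add_apply, hJ1, constUnit_apply]

end BoundaryProblem

/-! ### The Hamiltonian of the geodesic flow -/

section Hamiltonian
variable {E : Type*} [NormedAddCommGroup E] [NormedSpace ℝ E]

/-- A Riemannian metric on the vector space `E`: a smooth family of positive definite symmetric
bilinear forms on `E`. -/
structure IsMetricField (G : E → E →L[ℝ] E →L[ℝ] ℝ) : Prop where
  contDiff : ContDiff ℝ ∞ G
  symm : ∀ x v w, G x v w = G x w v
  pos : ∀ x v, v ≠ 0 → 0 < G x v v

/-- The inverse of a metric, a family of operators from covectors to vectors. (It is zero where the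
metric is not invertible, which does not happen in finite dimension.) -/
def cometric (G : E → E →L[ℝ] E →L[ℝ] ℝ) (x : E) : (E →L[ℝ] ℝ) →L[ℝ] E :=
  (G x).inverse

/-- The Hamiltonian `H(x, p) = |p|² / 2` of the geodesic flow. -/
def hamiltonian (G : E → E →L[ℝ] E →L[ℝ] ℝ) (u : E × (E →L[ℝ] ℝ)) : ℝ :=
  (1 / 2) * u.2 (cometric G u.1 u.2)

/-- The Hamiltonian vector field `(∂H/∂p, -∂H/∂x)` of the geodesic flow. -/
def geodesicField (G : E → E →L[ℝ] E →L[ℝ] ℝ) (u : E × (E →L[ℝ] ℝ)) : E × (E →L[ℝ] ℝ) :=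
  (cometric G u.1 u.2, -((1 / 2 : ℝ) • u.2.comp ((fderiv ℝ (cometric G) u.1).flip u.2)))

variable {G : E → E →L[ℝ] E →L[ℝ] ℝ}

lemma IsMetricField.self_nonneg (hG : IsMetricField G) (x v : E) : 0 ≤ G x v v := by
  by_cases h : v = 0
  · simp [h]
  · exact (hG.pos x v h).le

/-- Cauchy-Schwarz inequality. -/
lemma IsMetricField.sq_apply_le (hG : IsMetricField G) (x v w : E) :
    (G x v w) ^ 2 ≤ G x v v * G x w w := by
  by_cases hv : v = 0
  · simp [hv]
  have hp := hG.pos x v hv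
  have h := hG.self_nonneg x (G x v v • w - G x v w • v)
  simp only [map_sub, map_smul, sub_apply, smul_apply,
    smul_eq_mul, hG.symm x w v] at h
  have : 0 ≤ G x v v * (G x v v * G x w w - (G x v w) ^ 2) := by nlinarith
  have := nonneg_of_mul_nonneg_right this hp
  linarith

lemma geodesicField_zero_right (x : E) : geodesicField G (x, 0) = 0 := by
  simp [geodesicField]

variable [FiniteDimensional ℝ E]

lemma IsMetricField.exists_equiv (hG : IsMetricField G) (x : E) :
    ∃ e : E ≃L[ℝ] (E →L[ℝ] ℝ), (e : E →L[ℝ] (E →L[ℝ] ℝ)) = G x := by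
  have hinj : Function.Injective (G x : E →ₗ[ℝ] (E →L[ℝ] ℝ)) := by
    rw [injective_iff_map_eq_zero]
    intro v hv
    by_contra h
    have := hG.pos x v h
    have h2 : G x v = 0 := hv
    simp [h2] at this
  have hd : Module.finrank ℝ E = Module.finrank ℝ (E →L[ℝ] ℝ) := by
    rw [← LinearEquiv.finrank_eq (LinearMap.toContinuousLinearMap (𝕜 := ℝ) (E := E) (F' := ℝ))]
    exact (Subspace.dual_finrank_eq (K := ℝ) (V := E)).symm
  refine ⟨(LinearEquiv.ofInjectiveOfFinrankEq _ hinj hd).toContinuousLinearEquiv, ?_⟩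
  ext v w
  rfl

lemma IsMetricField.apply_cometric (hG : IsMetricField G) (x : E) (p : E →L[ℝ] ℝ) :
    G x (cometric G x p) = p := by
  obtain ⟨e, he⟩ := hG.exists_equiv x
  rw [cometric, ← he, ContinuousLinearMap.inverse_equiv]
  simp

lemma IsMetricField.cometric_apply (hG : IsMetricField G) (x : E) (v : E) :
    cometric G x (G x v) = v := by
  obtain ⟨e, he⟩ := hG.exists_equiv x
  rw [cometric, ← he, ContinuousLinearMap.inverse_equiv]
  simp

lemma IsMetricField.cometric_symm (hG : IsMetricField G) (x : E) (p q : E →L[ℝ] ℝ) :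
    p (cometric G x q) = q (cometric G x p) := by
  conv_lhs => rw [← hG.apply_cometric x p]
  conv_rhs => rw [← hG.apply_cometric x q]
  rw [hG.symm]

lemma IsMetricField.contDiff_cometric (hG : IsMetricField G) : ContDiff ℝ ∞ (cometric G) := by
  rw [contDiff_iff_contDiffAt]
  intro x
  obtain ⟨e, he⟩ := hG.exists_equiv x
  have := contDiffAt_map_inverse (n := ∞) e
  rw [he] at this
  exact this.comp x hG.contDiff.contDiffAt

lemma IsMetricField.contDiff_fderiv_cometric (hG : IsMetricField G) :
    ContDiff ℝ 1 (fderiv ℝ (cometric G)) :=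
  hG.contDiff_cometric.fderiv_right (by rw [one_add_one_eq_two]; exact WithTop.coe_le_coe.2 le_top)

lemma IsMetricField.contDiff_geodesicField (hG : IsMetricField G) :
    ContDiff ℝ 1 (geodesicField G) := by
  have h1 : ContDiff ℝ 1 (cometric G) := hG.contDiff_cometric.of_le (by simp)
  have h2 := hG.contDiff_fderiv_cometric
  refine ContDiff.prodMk ((h1.comp contDiff_fst).clm_apply contDiff_snd) ?_
  refine (ContDiff.const_smul _ (contDiff_snd.clm_comp (ContDiff.clm_apply ?_ contDiff_snd))).neg
  exact (ContinuousLinearMap.flipₗᵢ ℝ E (E →L[ℝ] ℝ) E).contDiff.comp (h2.comp contDiff_fst)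

lemma IsMetricField.hasFDerivAt_cometric (hG : IsMetricField G) (x : E) :
    HasFDerivAt (cometric G) (fderiv ℝ (cometric G) x) x :=
  (hG.contDiff_cometric.differentiable (by simp) x).hasFDerivAt

/-- The derivative of the velocity `∂H/∂p`. -/
lemma IsMetricField.hasFDerivAt_velocity (hG : IsMetricField G) (u : E × (E →L[ℝ] ℝ)) :
    HasFDerivAt (fun u : E × (E →L[ℝ] ℝ) ↦ cometric G u.1 u.2)
      ((cometric G u.1).comp (ContinuousLinearMap.snd ℝ E (E →L[ℝ] ℝ)) +
        ((fderiv ℝ (cometric G) u.1).comp (ContinuousLinearMap.fst ℝ E (E →L[ℝ] ℝ))).flip u.2)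
      u :=
  HasFDerivAt.clm_apply ((hG.hasFDerivAt_cometric u.1).comp u hasFDerivAt_fst) hasFDerivAt_snd

lemma IsMetricField.fderiv_geodesicField_fst (hG : IsMetricField G) (u v : E × (E →L[ℝ] ℝ)) :
    (fderiv ℝ (geodesicField G) u v).1 =
      cometric G u.1 v.2 + fderiv ℝ (cometric G) u.1 v.1 u.2 := by
  have h := (hG.contDiff_geodesicField.differentiable one_ne_zero u).hasFDerivAt.fst
  rw [show (fderiv ℝ (geodesicField G) u v).1 =
    ((ContinuousLinearMap.fst ℝ _ _).comp (fderiv ℝ (geodesicField G) u)) v from rfl,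
    h.unique (hG.hasFDerivAt_velocity u)]
  simp

lemma IsMetricField.hasFDerivAt_hamiltonian (hG : IsMetricField G) (u : E × (E →L[ℝ] ℝ)) :
    ∃ H' : (E × (E →L[ℝ] ℝ)) →L[ℝ] ℝ, HasFDerivAt (hamiltonian G) H' u ∧ ∀ v,
      H' v = v.2 (cometric G u.1 u.2) + (1 / 2) * u.2 (fderiv ℝ (cometric G) u.1 v.1 u.2) := by
  have h := (HasFDerivAt.clm_apply (hasFDerivAt_snd (p := u) (𝕜 := ℝ))
    (hG.hasFDerivAt_velocity u)).const_mul (1 / 2 : ℝ)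
  refine ⟨_, h, fun v ↦ ?_⟩
  simp [hG.cometric_symm u.1 u.2 v.2]
  ring

/-- The linearization of the geodesic field at the origin, which has square zero: it maps a momentum
to the corresponding velocity, and kills the positions. -/
lemma IsMetricField.fderiv_geodesicField_zero (hG : IsMetricField G) (v : E × (E →L[ℝ] ℝ)) :
    fderiv ℝ (geodesicField G) 0 v = (cometric G 0 v.2, 0) := by
  ext1
  · simp [hG.fderiv_geodesicField_fst]
  · -- the second component is quadratic in the momentum, so its derivative vanishes
    have h := (hG.contDiff_geodesicField.differentiable one_ne_zero 0).hasFDerivAt.snd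
    have h2 := hG.contDiff_fderiv_cometric
    have h3 : DifferentiableAt ℝ (fun u : E × (E →L[ℝ] ℝ) ↦
        (fderiv ℝ (cometric G) u.1).flip u.2) 0 := by
      refine DifferentiableAt.clm_apply ?_ differentiableAt_snd
      exact ((ContinuousLinearMap.flipₗᵢ ℝ E (E →L[ℝ] ℝ) E).contDiff.comp
        (h2.comp contDiff_fst)).differentiable one_ne_zero 0
    have h4 := ((HasFDerivAt.clm_comp (hasFDerivAt_snd (p := (0 : E × (E →L[ℝ] ℝ))) (𝕜 := ℝ))
      h3.hasFDerivAt).const_smul (1 / 2 : ℝ)).neg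
    have h5 := h.unique h4
    have h6 := DFunLike.congr_fun h5 v
    change (fderiv ℝ (geodesicField G) 0 v).2 = _ at h6
    rw [h6]
    simp
end Hamiltonian

/-! ### The energy of the geodesics normal to a subspace -/

section Curve
variable {F : Type*} [NormedAddCommGroup F] [NormedSpace ℝ F] [CompleteSpace F]

/-- A continuous map on `[0, 1]` which is a primitive of a continuous map extends to a `C¹` curve
defined on `ℝ`. -/
lemma exists_curve_of_eq_primitiveUnit {w z : C(unitInterval, F)} {c : F}
    (h : w = constUnit c + primitiveUnit z) :
    ∃ W : ℝ → F, ContDiff ℝ 1 W ∧ (∀ t : unitInterval, W t = w t) ∧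
      ∀ t : unitInterval, HasDerivAt W (z t) t := by
  refine ⟨fun t ↦ c + ∫ s in (0 : ℝ)..t, extendUnit z s, ?_, fun t ↦ ?_, fun t ↦ ?_⟩
  · rw [contDiff_one_iff_deriv]
    refine ⟨fun t ↦ (hasDerivAt_integral_extendUnit z c t).differentiableAt, ?_⟩
    rw [funext fun t ↦ (hasDerivAt_integral_extendUnit z c t).deriv]
    exact continuous_extendUnit z
  · rw [h]; rfl
  · convert! hasDerivAt_integral_extendUnit z c t using 1
    exact (Set.IccExtend_val _ z t).symm

/-- A function on `[0, 1]` with constant derivative is affine. -/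
lemma eq_add_of_hasDerivAt_const {q : ℝ → ℝ} {c : ℝ}
    (h : ∀ t : unitInterval, HasDerivAt q c t) (t : unitInterval) : q t = q 0 + c * t := by
  have h1 : ∀ s ∈ Set.Icc (0 : ℝ) 1, HasDerivAt (fun s ↦ q s - c * s) 0 s := fun s hs ↦ by
    have := HasDerivAt.fun_sub (h ⟨s, hs⟩) ((hasDerivAt_id s).const_mul c)
    rw [mul_one, sub_self] at this
    exact this
  have h2 := constant_of_has_deriv_right_zero (a := (0 : ℝ)) (b := 1) (f := fun s ↦ q s - c * s)
    (fun s hs ↦ (h1 s hs).continuousAt.continuousWithinAt)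
    (fun s hs ↦ (h1 s ⟨hs.1, hs.2.le⟩).hasDerivWithinAt) t t.2
  linarith

end Curve

section Potential
variable {E : Type*} [NormedAddCommGroup E] [NormedSpace ℝ E] [FiniteDimensional ℝ E]
  {G : E → E →L[ℝ] E →L[ℝ] ℝ}

/-- The integral equation of the geodesic flow with initial condition `c`. -/
def IsGeodesicSolution (hG : IsMetricField G) (c : E × (E →L[ℝ] ℝ))
    (u : C(unitInterval, E × (E →L[ℝ] ℝ))) : Prop :=
  u = constUnit c + primitiveUnit
    (ContinuousMap.postcompOp (geodesicField G) hG.contDiff_geodesicField.continuous u)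

lemma IsMetricField.two_mul_hamiltonian (hG : IsMetricField G) (u : E × (E →L[ℝ] ℝ)) :
    2 * hamiltonian G u = G u.1 (cometric G u.1 u.2) (cometric G u.1 u.2) := by
  rw [hG.apply_cometric, hamiltonian]; ring

/-- Cauchy-Schwarz inequality between momenta and vectors. It becomes the eikonal inequality when
`df = 2 p` and `f` is twice the energy. -/
lemma IsMetricField.sq_momentum_le (hG : IsMetricField G) (u : E × (E →L[ℝ] ℝ)) (v : E) :
    (u.2 v) ^ 2 ≤ 2 * hamiltonian G u * G u.1 v v := by
  rw [hG.two_mul_hamiltonian]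
  have := hG.sq_apply_le u.1 (cometric G u.1 u.2) v
  rwa [hG.apply_cometric] at this ⊢

/-- Conservation of energy. -/
lemma IsGeodesicSolution.hamiltonian_eq {hG : IsMetricField G} {c : E × (E →L[ℝ] ℝ)}
    {u : C(unitInterval, E × (E →L[ℝ] ℝ))} (h : IsGeodesicSolution hG c u) (t : unitInterval) :
    hamiltonian G (u t) = hamiltonian G (u 1) := by
  obtain ⟨U, -, hU, hU'⟩ := exists_curve_of_eq_primitiveUnit h
  have key : ∀ t : unitInterval, HasDerivAt (fun s ↦ hamiltonian G (U s)) 0 t := by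
    intro t
    obtain ⟨H', hH', hH'v⟩ := hG.hasFDerivAt_hamiltonian (U t)
    have := hH'.comp_hasDerivAt (t : ℝ) (hU' t)
    rw [hH'v, hU t] at this
    convert! this using 1
    simp [geodesicField, ContinuousLinearMap.flip_apply]
  have h0 := eq_add_of_hasDerivAt_const key t
  have h1 := eq_add_of_hasDerivAt_const key 1
  rw [hU] at h0 h1
  rw [h0, h1]; simp

/-- First variation of the energy: for a family of geodesics with end point `ξ` at time `1`, whose
initial momenta annihilate the variations of the initial points, the derivative of the energy
with respect to `ξ` is the final momentum. -/
lemma hasFDerivAt_energy (hG : IsMetricField G) {L : E →L[ℝ] E × (E →L[ℝ] ℝ)}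
    (hL : ∀ η a, (L η).2 (L a).1 = 0) {S : E → E × C(unitInterval, E × (E →L[ℝ] ℝ))} {ξ₀ : E}
    (hS : DifferentiableAt ℝ S ξ₀)
    (heq : ∀ᶠ ξ in 𝓝 ξ₀, ((S ξ).2 1).1 = ξ ∧ IsGeodesicSolution hG (L (S ξ).1) (S ξ).2) :
    HasFDerivAt (fun ξ ↦ hamiltonian G ((S ξ).2 1)) ((S ξ₀).2 1).2 ξ₀ := by
  have hS' := hS.hasFDerivAt
  set S' := fderiv ℝ S ξ₀
  set X := geodesicField G with hX
  have hXc := hG.contDiff_geodesicField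
  set u := (S ξ₀).2 with hu
  have hueq : IsGeodesicSolution hG (L (S ξ₀).1) u := heq.self_of_nhds.2
  have hev : ∀ t : unitInterval, HasFDerivAt (fun ξ ↦ (S ξ).2 t)
      ((ContinuousMap.evalCLM ℝ t).comp ((ContinuousLinearMap.snd ℝ _ _).comp S')) ξ₀ := fun t ↦
    (ContinuousMap.evalCLM ℝ t).hasFDerivAt_comp hS'.snd
  -- the derivative of the energy at time `t` does not depend on `t`
  have hHt : ∀ t : unitInterval, ∃ H' : (E × (E →L[ℝ] ℝ)) →L[ℝ] ℝ,
      HasFDerivAt (fun ξ ↦ hamiltonian G ((S ξ).2 1))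
        (H'.comp ((ContinuousMap.evalCLM ℝ t).comp ((ContinuousLinearMap.snd ℝ _ _).comp S'))) ξ₀
      ∧ ∀ v, H' v = v.2 (cometric G (u t).1 (u t).2) +
        (1 / 2) * (u t).2 (fderiv ℝ (cometric G) (u t).1 v.1 (u t).2) := by
    intro t
    obtain ⟨H', hH', hH'v⟩ := hG.hasFDerivAt_hamiltonian (u t)
    refine ⟨H', (hH'.comp ξ₀ (hev t)).congr_of_eventuallyEq ?_, hH'v⟩
    filter_upwards [heq] with ξ hξ
    exact (hξ.2.hamiltonian_eq t).symm
  obtain ⟨H₁, hH₁, -⟩ := hHt 1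
  convert! hH₁ using 1
  ext e
  set a := (S' e).1
  set v := (S' e).2 with hv
  -- the variation of the geodesic solves the linearized equation
  obtain ⟨N', hN', hN'v⟩ := exists_hasFDerivAt_postcompOp hXc u
  have hlin : v = constUnit (L a) + primitiveUnit (N' v) := by
    have h1 : HasFDerivAt (fun ξ ↦ (S ξ).2) ((ContinuousLinearMap.snd ℝ _ _).comp S') ξ₀ := hS'.snd
    have h2 : HasFDerivAt (fun ξ ↦ constUnit (L (S ξ).1) + primitiveUnit
        (ContinuousMap.postcompOp X hXc.continuous (S ξ).2))
        ((constUnit.comp L).comp ((ContinuousLinearMap.fst ℝ _ _).comp S') +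
          (primitiveUnit.comp N').comp ((ContinuousLinearMap.snd ℝ _ _).comp S')) ξ₀ := by
      have h3 : HasFDerivAt
          (fun u ↦ primitiveUnit (ContinuousMap.postcompOp X hXc.continuous u))
          (primitiveUnit.comp N') u :=
        primitiveUnit.hasFDerivAt_comp hN'
      exact ((constUnit.comp L).hasFDerivAt.comp ξ₀ hS'.fst).add
        (HasFDerivAt.comp
          (g := fun u ↦ primitiveUnit (ContinuousMap.postcompOp X hXc.continuous u)) ξ₀ h3 h1)
    have h4 := h1.unique (h2.congr_of_eventuallyEq (heq.mono fun ξ hξ ↦ hξ.2))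
    exact DFunLike.congr_fun h4 e
  have hv1 : (v 1).1 = e := by
    have h1 : HasFDerivAt (fun ξ ↦ ((S ξ).2 1).1) ((ContinuousLinearMap.fst ℝ _ _).comp
        ((ContinuousMap.evalCLM ℝ 1).comp ((ContinuousLinearMap.snd ℝ _ _).comp S'))) ξ₀ :=
      (hev 1).fst
    have h2 := h1.unique ((hasFDerivAt_id ξ₀).congr_of_eventuallyEq (heq.mono fun ξ hξ ↦ hξ.1))
    exact DFunLike.congr_fun h2 e
  obtain ⟨U, -, hU, hU'⟩ := exists_curve_of_eq_primitiveUnit hueq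
  obtain ⟨V, -, hV, hV'⟩ := exists_curve_of_eq_primitiveUnit hlin
  -- along the geodesic, the pairing of the momentum with the variation has constant derivative
  have hq : ∀ t : unitInterval, HasDerivAt (fun s ↦ (U s).2 (V s).1) (H₁ (v 1)) t := by
    intro t
    obtain ⟨H', hH', hH'v⟩ := hHt t
    have h1 : H₁ (v 1) = H' (v t) := DFunLike.congr_fun (hH₁.unique hH') e
    have h2 : HasDerivAt (fun s ↦ (U s).2) (X (u t)).2 (t : ℝ) :=
      (ContinuousLinearMap.snd ℝ E (E →L[ℝ] ℝ)).hasFDerivAt.comp_hasDerivAt (t : ℝ) (hU' t)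
    have h3 : HasDerivAt (fun s ↦ (V s).1) (N' v t).1 (t : ℝ) :=
      (ContinuousLinearMap.fst ℝ E (E →L[ℝ] ℝ)).hasFDerivAt.comp_hasDerivAt (t : ℝ) (hV' t)
    have h4 := h2.clm_apply h3
    rw [h1, hH'v]
    convert! h4 using 1
    rw [hN'v, hG.fderiv_geodesicField_fst, hU, hV]
    simp [hX, geodesicField, ContinuousLinearMap.flip_apply, hG.cometric_symm (u t).1 (u t).2]
    ring
  have h1 := eq_add_of_hasDerivAt_const hq 1
  have hU0 : U 0 = L (S ξ₀).1 := by
    rw [show U 0 = u 0 from hU 0, hueq, ContinuousMap.add_apply, primitiveUnit_zero_right]; simp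
  have hV0 : V 0 = L a := by
    rw [show V 0 = v 0 from hV 0, hlin, ContinuousMap.add_apply, primitiveUnit_zero_right]; simp
  simp only [hU, hV, hU0, hV0, hL, hv1] at h1
  simpa using h1

/-- Near a point of a linear subspace `ker P`, where `P` is an orthogonal projection at that point,
the normal geodesics of `ker P` define a function `f` which is `C²`, has derivative `2 p` with `p`
the final momentum, and satisfies the eikonal inequality. At the end point of such a geodesic, `f` is
the square of its constant speed. -/
theorem exists_sqDist_potential (hG : IsMetricField G) (P : E →L[ℝ] E)
    (hP : ∀ v, P (P v) = P v) (hsym : ∀ v w, G 0 (P v) w = G 0 v (P w)) :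
    ∃ (f : E → ℝ) (p : E → E →L[ℝ] ℝ), f 0 = 0 ∧ (∀ ξ, 0 ≤ f ξ) ∧ ContDiffAt ℝ 1 p 0 ∧
      (∀ᶠ ξ in 𝓝 0, HasFDerivAt f ((2 : ℝ) • p ξ) ξ) ∧ (∀ v, fderiv ℝ p 0 v = G 0 (P v)) ∧
      (∀ᶠ ξ in 𝓝 0, ∀ v, (p ξ v) ^ 2 ≤ f ξ * G ξ v v) ∧
      (∀ᶠ ξ in 𝓝 0, P ξ = 0 → f ξ = 0) ∧
      ∀ r > 0, ∀ᶠ ξ in 𝓝 0, ∃ γ : ℝ → E, ContDiff ℝ 1 γ ∧ P (γ 0) = 0 ∧ γ 1 = ξ ∧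
        ∀ t ∈ Set.Icc (0 : ℝ) 1, ‖γ t‖ < r ∧ G (γ t) (deriv γ t) (deriv γ t) = f ξ := by
  -- the initial data of the normal geodesics: the momentum `G 0 (P η)` is defined by the metric at
  -- the origin, but it vanishes on `ker P`, so it is conormal at every point of `ker P`
  set L : E →L[ℝ] E × (E →L[ℝ] ℝ) := (ContinuousLinearMap.id ℝ E - P).prod ((G 0).comp P) with hL
  have hLapp : ∀ η, L η = (η - P η, G 0 (P η)) := fun η ↦ rfl
  have hL0 : ∀ η a, (L η).2 (L a).1 = 0 := fun η a ↦ by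
    simp only [hLapp]
    rw [hsym]
    simp [hP]
  have hA := hG.fderiv_geodesicField_zero
  obtain ⟨S, hS0, hSC, hSeq, hSuniq, hSD⟩ := exists_contDiffAt_boundary_solution
    hG.contDiff_geodesicField (geodesicField_zero_right 0) (fun v ↦ by simp [hA]) L
    (ContinuousLinearMap.fst ℝ E (E →L[ℝ] ℝ)) (fun η ↦ by simp [hA, hLapp, hG.cometric_apply])
  have hSD1 : ∀ᶠ ξ in 𝓝 0, DifferentiableAt ℝ S ξ :=
    (hSC.eventually (by simp)).mono fun ξ h ↦ h.differentiableAt one_ne_zero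
  have hSeq' : ∀ᶠ ξ in 𝓝 0, ((S ξ).2 1).1 = ξ ∧ IsGeodesicSolution hG (L (S ξ).1) (S ξ).2 := hSeq
  have hev : HasFDerivAt (fun ξ ↦ ((S ξ).2 1).2) ((ContinuousLinearMap.snd ℝ _ _).comp
      ((ContinuousMap.evalCLM ℝ 1).comp ((ContinuousLinearMap.snd ℝ _ _).comp (fderiv ℝ S 0)))) 0 :=
    ((ContinuousMap.evalCLM ℝ (1 : unitInterval)).hasFDerivAt_comp
      (hSC.differentiableAt one_ne_zero).hasFDerivAt.snd).snd
  refine ⟨fun ξ ↦ 2 * hamiltonian G ((S ξ).2 1), fun ξ ↦ ((S ξ).2 1).2, ?_, ?_, ?_, ?_, ?_, ?_, ?_,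
    ?_⟩
  · simp [hS0, hamiltonian]
  · intro ξ
    exact (hG.self_nonneg _ _).trans_eq (hG.two_mul_hamiltonian _).symm
  · exact ((ContinuousLinearMap.snd ℝ E (E →L[ℝ] ℝ)).comp
      ((ContinuousMap.evalCLM ℝ (1 : unitInterval)).comp
        (ContinuousLinearMap.snd ℝ _ _))).contDiff.contDiffAt.comp (0 : E) hSC
  · filter_upwards [hSD1, hSeq'.eventually_nhds] with ξ h1 h2
    exact (hasFDerivAt_energy hG hL0 h1 h2).const_mul 2
  · intro v
    rw [hev.fderiv]
    change ((fderiv ℝ S 0 v).2 1).2 = _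
    rw [hSD, hA, hLapp]
    simp
  · filter_upwards [hSeq'] with ξ h v
    have := hG.sq_momentum_le ((S ξ).2 1) v
    rwa [h.1] at this
  · -- points of the subspace are the constant solutions
    have ht : Tendsto (fun y : E ↦ (y, (constUnit (y, 0) :
        C(unitInterval, E × (E →L[ℝ] ℝ))))) (𝓝 0) (𝓝 0) := by
      have : Continuous (fun y : E ↦ (y, (constUnit (y, 0) :
        C(unitInterval, E × (E →L[ℝ] ℝ))))) :=
        continuous_id.prodMk (constUnit.continuous.comp (continuous_id.prodMk continuous_const))
      have h := this.tendsto 0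
      have h0 : (constUnit ((0 : E), (0 : E →L[ℝ] ℝ)) :
        C(unitInterval, E × (E →L[ℝ] ℝ))) = 0 := map_zero _
      rw [h0] at h
      exact h
    filter_upwards [ht.eventually hSuniq] with y hy hPy
    have h1 : ContinuousMap.postcompOp (geodesicField G) hG.contDiff_geodesicField.continuous
        (constUnit (y, 0)) = 0 := by
      ext1 t
      exact geodesicField_zero_right y
    have h2 := hy (by
      simp only [h1, map_zero, add_zero, hLapp, hPy, sub_zero])
    have h3 : S y = (y, constUnit (y, 0)) := h2
    simp [h3, hamiltonian]
  · intro r hr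
    have hsmall : ∀ᶠ ξ in 𝓝 0, ‖(S ξ).2‖ < r := by
      have : ContinuousAt (fun ξ ↦ ‖(S ξ).2‖) 0 := hSC.continuousAt.snd.norm
      exact this.eventually_lt_const (by simpa [hS0] using hr)
    filter_upwards [hsmall, hSeq'] with ξ h1 h2
    obtain ⟨U, hUC, hU, hU'⟩ := exists_curve_of_eq_primitiveUnit h2.2
    have hU0 : U 0 = L (S ξ).1 := by
      rw [show U 0 = (S ξ).2 0 from hU 0, h2.2, ContinuousMap.add_apply,
        primitiveUnit_zero_right]
      simp
    refine ⟨fun t ↦ (U t).1, contDiff_fst.comp hUC, ?_, ?_, ?_⟩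
    · simp only [hU0, hLapp, map_sub, hP, sub_self]
    · exact (congrArg Prod.fst (hU 1)).trans h2.1
    · intro t ht
      have hUt : U t = (S ξ).2 ⟨t, ht⟩ := hU ⟨t, ht⟩
      have h3 : HasDerivAt (fun s ↦ (U s).1) (geodesicField G ((S ξ).2 ⟨t, ht⟩)).1 t :=
        (ContinuousLinearMap.fst ℝ E (E →L[ℝ] ℝ)).hasFDerivAt.comp_hasDerivAt t (hU' ⟨t, ht⟩)
      refine ⟨?_, ?_⟩
      · simp only [hUt]
        exact (norm_fst_le _).trans_lt (((S ξ).2.norm_coe_le_norm _).trans_lt h1)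
      · rw [h3.deriv]
        simp only [hUt]
        rw [← h2.2.hamiltonian_eq ⟨t, ht⟩, hG.two_mul_hamiltonian]
        rfl

end Potential

/-! ### A Hermitian metric in a holomorphic chart -/

lemma contDiffOn_bilin {E : Type*} [NormedAddCommGroup E] [NormedSpace ℝ E]
    [FiniteDimensional ℝ E] {m : WithTop ℕ∞} {G : E → E →L[ℝ] E →L[ℝ] ℝ} {s : Set E}
    (h : ∀ v w, ContDiffOn ℝ m (fun x ↦ G x v w) s) : ContDiffOn ℝ m G s :=
  contDiffOn_clm_apply.2 fun v ↦ contDiffOn_clm_apply.2 fun w ↦ h v w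

/-- The image of a constant vector field under an analytic map is a smooth vector field along this
map. -/
lemma contMDiffOn_mfderiv_apply_const {E E' H M : Type*} [NormedAddCommGroup E] [NormedSpace ℝ E]
    [NormedAddCommGroup E'] [NormedSpace ℝ E'] [TopologicalSpace H] {I : ModelWithCorners ℝ E' H}
    [TopologicalSpace M] [ChartedSpace H M] [IsManifold I ω M] {f : E → M} {s : Set E}
    (hf : ContMDiffOn 𝓘(ℝ, E) I ω f s) (hs : IsOpen s) (v : E) :
    ContMDiffOn 𝓘(ℝ, E) (I.prod 𝓘(ℝ, E')) ∞
      (fun ξ ↦ (Bundle.TotalSpace.mk' E' (f ξ) (mfderiv 𝓘(ℝ, E) I f ξ v) :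
        Bundle.TotalSpace E' (fun x : M ↦ TangentSpace I x))) s := by
  have h1 := hf.contMDiffOn_tangentMapWithin (m := ∞) le_top hs.uniqueMDiffOn
  have h2 : ContMDiffOn 𝓘(ℝ, E) (𝓘(ℝ, E).prod 𝓘(ℝ, E)) ∞
      (fun ξ : E ↦ (Bundle.TotalSpace.mk' E ξ v : TangentBundle 𝓘(ℝ, E) E)) s :=
    (contMDiffOn_vectorSpace_iff_contDiffOn (V := fun _ ↦ v)).2 contDiffOn_const
  refine (h1.comp h2 fun ξ hξ ↦ hξ).congr fun ξ hξ ↦ ?_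
  simp only [tangentMapWithin, Function.comp_apply]
  rw [mfderivWithin_of_mem_nhds (hs.mem_nhds hξ)]

section Charts
variable {n : ℕ} {X : Type*} [TopologicalSpace X] [ChartedSpace (Cn n) X]

/-- A holomorphic chart is a chart of the underlying real analytic manifold. -/
lemma mem_maximalAtlas_real {z : OpenPartialHomeomorph X (Cn n)}
    (hz : z ∈ IsManifold.maximalAtlas 𝓘(ℂ, Cn n) ω X) :
    z ∈ IsManifold.maximalAtlas 𝓘(ℝ, Cn n) ω X := by
  rw [IsManifold.maximalAtlas, mem_maximalAtlas_iff] at hz ⊢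
  have key : ∀ e ∈ contDiffGroupoid ω 𝓘(ℂ, Cn n), e ∈ contDiffGroupoid ω 𝓘(ℝ, Cn n) := by
    intro e h
    rw [contDiffGroupoid, mem_groupoid_of_pregroupoid] at h ⊢
    exact ⟨h.1.restrict_scalars ℝ, h.2.restrict_scalars ℝ⟩
  exact fun e he ↦ ⟨key _ (hz e he).1, key _ (hz e he).2⟩

variable [IsManifold 𝓘(ℂ, Cn n) ω X]

/-- The expression in the chart `z` of a Hermitian metric: the pullback of the metric by the inverse
of `z`. -/
def HermitianMetric.inChart (g : HermitianMetric n X) (z : OpenPartialHomeomorph X (Cn n))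
    (ξ : Cn n) : Cn n →L[ℝ] Cn n →L[ℝ] ℝ :=
  let B : Cn n →L[ℝ] Cn n →L[ℝ] ℝ := g.inner (z.symm ξ)
  let D : Cn n →L[ℝ] Cn n := mfderiv 𝓘(ℝ, Cn n) 𝓘(ℝ, Cn n) z.symm ξ
  B.bilinearComp D D

lemma HermitianMetric.inChart_symm (g : HermitianMetric n X)
    (z : OpenPartialHomeomorph X (Cn n)) (ξ v w : Cn n) :
    g.inChart z ξ v w = g.inChart z ξ w v :=
  g.symm (z.symm ξ) (mfderiv 𝓘(ℝ, Cn n) 𝓘(ℝ, Cn n) z.symm ξ v)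
    (mfderiv 𝓘(ℝ, Cn n) 𝓘(ℝ, Cn n) z.symm ξ w)

lemma HermitianMetric.inChart_pos (g : HermitianMetric n X)
    {z : OpenPartialHomeomorph X (Cn n)} (hz : z ∈ IsManifold.maximalAtlas 𝓘(ℂ, Cn n) ω X)
    {ξ : Cn n} (hξ : ξ ∈ z.target) {v : Cn n} (hv : v ≠ 0) : 0 < g.inChart z ξ v v := by
  refine g.pos (z.symm ξ) (mfderiv 𝓘(ℝ, Cn n) 𝓘(ℝ, Cn n) z.symm ξ v) fun h ↦ hv ?_
  have hz' := mem_maximalAtlas_real hz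
  have h1 : MDifferentiableAt 𝓘(ℝ, Cn n) 𝓘(ℝ, Cn n) z.symm ξ :=
    (contMDiffAt_symm_of_mem_maximalAtlas hz' hξ).mdifferentiableAt (by simp)
  have h2 : MDifferentiableAt 𝓘(ℝ, Cn n) 𝓘(ℝ, Cn n) z (z.symm ξ) :=
    (contMDiffAt_of_mem_maximalAtlas hz' (z.map_target hξ)).mdifferentiableAt (by simp)
  have h3 := h2.hasMFDerivAt.comp ξ h1.hasMFDerivAt
  have h4 : HasMFDerivAt 𝓘(ℝ, Cn n) 𝓘(ℝ, Cn n) (z ∘ z.symm) ξ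
      (ContinuousLinearMap.id ℝ (TangentSpace 𝓘(ℝ, Cn n) ξ)) := by
    refine (hasMFDerivAt_id ξ).congr_of_eventuallyEq ?_
    filter_upwards [z.open_target.mem_nhds hξ] with y hy using z.right_inv hy
  have h5 : v = mfderiv 𝓘(ℝ, Cn n) 𝓘(ℝ, Cn n) z (z.symm ξ)
      (mfderiv 𝓘(ℝ, Cn n) 𝓘(ℝ, Cn n) z.symm ξ v) :=
    DFunLike.congr_fun (hasMFDerivAt_unique h4 h3) v
  rw [h5]
  exact (congrArg _ h).trans (map_zero _)

lemma HermitianMetric.contDiffOn_inChart (g : HermitianMetric n X)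
    {z : OpenPartialHomeomorph X (Cn n)} (hz : z ∈ IsManifold.maximalAtlas 𝓘(ℂ, Cn n) ω X) :
    ContDiffOn ℝ ∞ (g.inChart z) z.target := by
  let _ : Bundle.RiemannianBundle (fun x : X ↦ TangentSpace 𝓘(ℝ, Cn n) x) :=
    ⟨g.toContMDiffRiemannianMetric.toRiemannianMetric⟩
  have hz' := mem_maximalAtlas_real hz
  have hs : ∀ v : Cn n, ContMDiffOn 𝓘(ℝ, Cn n) (𝓘(ℝ, Cn n).prod 𝓘(ℝ, Cn n)) ∞
      (fun ξ ↦ (Bundle.TotalSpace.mk' (Cn n) (z.symm ξ)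
        (mfderiv 𝓘(ℝ, Cn n) 𝓘(ℝ, Cn n) z.symm ξ v) :
          Bundle.TotalSpace (Cn n) (fun x : X ↦ TangentSpace 𝓘(ℝ, Cn n) x))) z.target :=
    fun v ↦ contMDiffOn_mfderiv_apply_const (contMDiffOn_symm_of_mem_maximalAtlas hz')
      z.open_target v
  have h : ∀ v w : Cn n, ContDiffOn ℝ ∞ (fun ξ ↦ g.inChart z ξ v w) z.target := by
    intro v w
    have := ((hs v).inner_bundle (hs w)).contDiffOn
    exact this
  exact contDiffOn_bilin h

end Charts

/-! ### Lengths of paths in a chart -/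

section Lengths
variable {n : ℕ} {X : Type*} [TopologicalSpace X] [ChartedSpace (Cn n) X]
  [IsManifold 𝓘(ℂ, Cn n) ω X]

/-- The scalar product at `x`, with all tangent spaces written as the model space `ℂⁿ`. -/
def HermitianMetric.innerAt (g : HermitianMetric n X) (x : X) (v w : Cn n) : ℝ := g.inner x v w

/-- The speed of a path with respect to a Hermitian metric (it is zero where the path is not
differentiable). -/
def HermitianMetric.speed (g : HermitianMetric n X) (γ : ℝ → X) (t : ℝ) : ℝ :=
  √(g.innerAt (γ t) (mfderiv 𝓘(ℝ, ℝ) 𝓘(ℝ, Cn n) γ t 1) (mfderiv 𝓘(ℝ, ℝ) 𝓘(ℝ, Cn n) γ t 1))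

lemma HermitianMetric.pathELength_eq (g : HermitianMetric n X) (γ : ℝ → X) (a b : ℝ) :
    letI : Bundle.RiemannianBundle (fun x : X ↦ TangentSpace 𝓘(ℝ, Cn n) x) :=
      ⟨g.toContMDiffRiemannianMetric.toRiemannianMetric⟩
    Manifold.pathELength 𝓘(ℝ, Cn n) γ a b = ∫⁻ t in Set.Ioo a b, ENNReal.ofReal (g.speed γ t) := by
  let _ : Bundle.RiemannianBundle (fun x : X ↦ TangentSpace 𝓘(ℝ, Cn n) x) :=
    ⟨g.toContMDiffRiemannianMetric.toRiemannianMetric⟩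
  rw [Manifold.pathELength_eq_lintegral_mfderiv_Ioo]
  refine lintegral_congr fun t ↦ ?_
  rw [← ofReal_norm, norm_eq_sqrt_real_inner]
  rfl

/-- A point at distance less than `r` is joined by a `C¹` path of length less than `r`. -/
lemma HermitianMetric.exists_path_of_riemDist_lt (g : HermitianMetric n X) {x y : X} {r : ℝ≥0∞}
    (h : g.riemDist x y < r) :
    ∃ γ : ℝ → X, γ 0 = x ∧ γ 1 = y ∧
      ContMDiffOn 𝓘(ℝ, ℝ) 𝓘(ℝ, Cn n) 1 γ (Set.Icc 0 1) ∧
      ∫⁻ t in Set.Ioo 0 1, ENNReal.ofReal (g.speed γ t) < r := by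
  let _ : Bundle.RiemannianBundle (fun x : X ↦ TangentSpace 𝓘(ℝ, Cn n) x) :=
    ⟨g.toContMDiffRiemannianMetric.toRiemannianMetric⟩
  obtain ⟨γ, h0, h1, hγ, hl⟩ := Manifold.exists_lt_of_riemannianEDist_lt h
  refine ⟨γ, h0, h1, hγ, ?_⟩
  rwa [← g.pathELength_eq]

/-- The distance between the end points of a `C¹` path is at most the length of the path. -/
lemma HermitianMetric.riemDist_le_of_path (g : HermitianMetric n X) {γ : ℝ → X}
    (hγ : ContMDiffOn 𝓘(ℝ, ℝ) 𝓘(ℝ, Cn n) 1 γ (Set.Icc 0 1)) :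
    g.riemDist (γ 1) (γ 0) ≤ ∫⁻ t in Set.Ioo 0 1, ENNReal.ofReal (g.speed γ t) := by
  let _ : Bundle.RiemannianBundle (fun x : X ↦ TangentSpace 𝓘(ℝ, Cn n) x) :=
    ⟨g.toContMDiffRiemannianMetric.toRiemannianMetric⟩
  rw [← g.pathELength_eq]
  have h1 : Manifold.riemannianEDist 𝓘(ℝ, Cn n) (γ 1) (γ 0) ≤
      Manifold.pathELength 𝓘(ℝ, Cn n) γ 0 1 := by
    rw [Manifold.riemannianEDist_comm]
    exact Manifold.riemannianEDist_le_pathELength hγ rfl rfl zero_le_one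
  exact h1

/-- The speed of a path, in a chart. -/
lemma HermitianMetric.speed_eq_inChart (g : HermitianMetric n X)
    {z : OpenPartialHomeomorph X (Cn n)} (hz : z ∈ IsManifold.maximalAtlas 𝓘(ℂ, Cn n) ω X)
    {γ : ℝ → X} {c : ℝ → Cn n} {c' : Cn n} {t : ℝ} (hγ : γ =ᶠ[𝓝 t] z.symm ∘ c)
    (hc : HasDerivAt c c' t) (ht : c t ∈ z.target) :
    g.speed γ t = √(g.inChart z (c t) c' c') := by
  have h1 : MDifferentiableAt 𝓘(ℝ, Cn n) 𝓘(ℝ, Cn n) z.symm (c t) :=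
    (contMDiffAt_symm_of_mem_maximalAtlas (mem_maximalAtlas_real hz) ht).mdifferentiableAt
      (by simp)
  have h2 := h1.hasMFDerivAt.comp t hc.hasFDerivAt.hasMFDerivAt
  have h3 := (h2.congr_of_eventuallyEq hγ).mfderiv
  have h4 : (mfderiv 𝓘(ℝ, ℝ) 𝓘(ℝ, Cn n) γ t 1 : Cn n) =
      mfderiv 𝓘(ℝ, Cn n) 𝓘(ℝ, Cn n) z.symm (c t) c' := by
    refine (DFunLike.congr_fun h3 1).trans ?_
    exact congrArg (mfderiv 𝓘(ℝ, Cn n) 𝓘(ℝ, Cn n) z.symm (c t)) (one_smul ℝ c')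
  have h5 : γ t = z.symm (c t) := hγ.self_of_nhds
  rw [HermitianMetric.speed, h4, h5]
  rfl

/-- A function whose derivative is bounded by the metric varies along a path by at most the length
of the path. -/
lemma HermitianMetric.ofReal_abs_sub_le_length (g : HermitianMetric n X)
    {z : OpenPartialHomeomorph X (Cn n)} (hz : z ∈ IsManifold.maximalAtlas 𝓘(ℂ, Cn n) ω X)
    {s : Set (Cn n)} (hs : IsOpen s) {φ : Cn n → ℝ} (hφ : ContDiffOn ℝ 1 φ s)
    (hφ' : ∀ ξ ∈ s, ∀ v, |fderiv ℝ φ ξ v| ≤ √(g.inChart z ξ v v)) {γ : ℝ → X}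
    (hγ : ContMDiffOn 𝓘(ℝ, ℝ) 𝓘(ℝ, Cn n) 1 γ (Set.Icc 0 1)) {T : ℝ} (hT : T ∈ Set.Icc (0 : ℝ) 1)
    (hγs : ∀ t ∈ Set.Icc 0 T, γ t ∈ z.source ∧ z (γ t) ∈ s) :
    ENNReal.ofReal |φ (z (γ T)) - φ (z (γ 0))| ≤
      ∫⁻ t in Set.Ioo 0 1, ENNReal.ofReal (g.speed γ t) := by
  set c : ℝ → Cn n := fun t ↦ z (γ t) with hc
  have hcC : ContDiffOn ℝ 1 c (Set.Icc 0 T) := by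
    rw [← contMDiffOn_iff_contDiffOn]
    exact ((contMDiffOn_of_mem_maximalAtlas (mem_maximalAtlas_real hz)).of_le (by simp)).comp
      (hγ.mono (Set.Icc_subset_Icc_right hT.2)) fun t ht ↦ (hγs t ht).1
  have hφc : ContDiffOn ℝ 1 (φ ∘ c) (Set.Icc 0 T) := hφ.comp hcC fun t ht ↦ (hγs t ht).2
  have h1 := enorm_sub_le_lintegral_deriv_of_contDiffOn_Icc hφc hT.1
  rw [← ofReal_norm, Real.norm_eq_abs] at h1
  refine h1.trans ?_
  rw [← restrict_Ioo_eq_restrict_Icc]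
  refine (setLIntegral_mono' measurableSet_Ioo fun t ht ↦ ?_).trans
    (lintegral_mono_set (Set.Ioo_subset_Ioo_right hT.2))
  have ht' : t ∈ Set.Icc 0 T := Set.Ioo_subset_Icc_self ht
  have hcd : HasDerivAt c (deriv c t) t :=
    ((hcC.contDiffAt (Icc_mem_nhds ht.1 ht.2)).differentiableAt one_ne_zero).hasDerivAt
  have hφd : HasFDerivAt φ (fderiv ℝ φ (c t)) (c t) :=
    ((hφ.contDiffAt (hs.mem_nhds (hγs t ht').2)).differentiableAt one_ne_zero).hasFDerivAt
  have hγc : γ =ᶠ[𝓝 t] z.symm ∘ c := by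
    filter_upwards [Icc_mem_nhds ht.1 ht.2] with τ hτ
    exact (z.left_inv (hγs τ hτ).1).symm
  rw [(hφd.comp_hasDerivAt t hcd).deriv, ← ofReal_norm, Real.norm_eq_abs,
    g.speed_eq_inChart hz hγc hcd (z.map_source (hγs t ht').1)]
  exact ENNReal.ofReal_le_ofReal (hφ' _ (hγs t ht').2 _)

/-- The distance between the end points of a path of constant speed lying in a chart. -/
lemma HermitianMetric.riemDist_le_of_inChart (g : HermitianMetric n X)
    {z : OpenPartialHomeomorph X (Cn n)} (hz : z ∈ IsManifold.maximalAtlas 𝓘(ℂ, Cn n) ω X)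
    {c : ℝ → Cn n} (hc : ContDiff ℝ 1 c) {f : ℝ}
    (hcz : ∀ t ∈ Set.Icc (0 : ℝ) 1, c t ∈ z.target ∧
      g.inChart z (c t) (deriv c t) (deriv c t) = f) :
    g.riemDist (z.symm (c 1)) (z.symm (c 0)) ≤ ENNReal.ofReal (√f) := by
  have hγ : ContMDiffOn 𝓘(ℝ, ℝ) 𝓘(ℝ, Cn n) 1 (z.symm ∘ c) (Set.Icc 0 1) :=
    ((contMDiffOn_symm_of_mem_maximalAtlas (mem_maximalAtlas_real hz)).of_le (by simp)).comp
      (contMDiffOn_iff_contDiffOn.2 hc.contDiffOn) fun t ht ↦ (hcz t ht).1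
  refine (g.riemDist_le_of_path hγ).trans ?_
  have : ∀ t ∈ Set.Ioo (0 : ℝ) 1, ENNReal.ofReal (g.speed (z.symm ∘ c) t) =
      ENNReal.ofReal (√f) := fun t ht ↦ by
    have ht' := Set.Ioo_subset_Icc_self ht
    rw [g.speed_eq_inChart hz EventuallyEq.rfl
      (hc.differentiable one_ne_zero t).hasDerivAt (hcz t ht').1, (hcz t ht').2]
  rw [setLIntegral_congr_fun measurableSet_Ioo this]
  simp

/-- A path starting in the preimage of a closed ball of a chart either stays in the preimage of the
open ball, or reaches the preimage of the sphere before leaving the preimage of the closed ball. -/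
lemma exists_exit_time {E : Type*} [NormedAddCommGroup E] [ProperSpace E] {X : Type*}
    [TopologicalSpace X] [T2Space X] (z : OpenPartialHomeomorph X E) {R : ℝ}
    (hR : Metric.closedBall 0 R ⊆ z.target) {γ : ℝ → X} (hγ : ContinuousOn γ (Set.Icc 0 1))
    (h0 : γ 0 ∈ z.source) (h0' : ‖z (γ 0)‖ < R) :
    (∀ t ∈ Set.Icc (0 : ℝ) 1, γ t ∈ z.source ∧ ‖z (γ t)‖ < R) ∨
      ∃ T ∈ Set.Icc (0 : ℝ) 1, (∀ t ∈ Set.Icc 0 T, γ t ∈ z.source ∧ ‖z (γ t)‖ ≤ R) ∧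
        ‖z (γ T)‖ = R := by
  set K : Set X := z.symm '' Metric.closedBall 0 R with hK
  have hKc : IsClosed K :=
    ((isCompact_closedBall 0 R).image_of_continuousOn (z.continuousOn_symm.mono hR)).isClosed
  have hKmem : ∀ x ∈ K, x ∈ z.source ∧ ‖z x‖ ≤ R := by
    rintro x ⟨ξ, hξ, rfl⟩
    refine ⟨z.map_target (hR hξ), ?_⟩
    rw [z.right_inv (hR hξ)]
    simpa using hξ
  set A : Set X := z.source ∩ z ⁻¹' Metric.ball 0 R with hA
  have hAo : IsOpen A := z.isOpen_inter_preimage Metric.isOpen_ball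
  have hAK : A ⊆ K := fun x hx ↦
    ⟨z x, Metric.ball_subset_closedBall hx.2, z.left_inv hx.1⟩
  have hAmem : ∀ x, x ∈ A ↔ x ∈ z.source ∧ ‖z x‖ < R := fun x ↦ by simp [hA]
  by_cases hall : ∀ t ∈ Set.Icc (0 : ℝ) 1, γ t ∈ A
  · exact Or.inl fun t ht ↦ (hAmem _).1 (hall t ht)
  right
  push Not at hall
  obtain ⟨t₁, ht₁, ht₁A⟩ := hall
  set B : Set ℝ := Set.Icc 0 1 ∩ γ ⁻¹' Aᶜ with hB
  have hBc : IsClosed B := hγ.preimage_isClosed_of_isClosed isClosed_Icc hAo.isClosed_compl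
  have hBcomp : IsCompact B := isCompact_Icc.of_isClosed_subset hBc Set.inter_subset_left
  obtain ⟨T, hTB, hTmin⟩ := hBcomp.exists_isLeast ⟨t₁, ht₁, ht₁A⟩
  have hlt : ∀ t ∈ Set.Ico 0 T, γ t ∈ A := fun t ht ↦ by
    by_contra h
    exact absurd (hTmin ⟨⟨ht.1, ht.2.le.trans hTB.1.2⟩, h⟩) (not_le.2 ht.2)
  have hT0 : 0 < T := by
    refine lt_of_le_of_ne hTB.1.1 fun h ↦ hTB.2 ?_
    rw [← h]
    exact (hAmem _).2 ⟨h0, h0'⟩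
  have hTK : γ T ∈ K := by
    have h1 : ContinuousWithinAt γ (Set.Ico 0 T) T :=
      (hγ T hTB.1).mono fun t ht ↦ ⟨ht.1, ht.2.le.trans hTB.1.2⟩
    refine hKc.closure_subset_iff.2 hAK (h1.mem_closure ?_ fun t ht ↦ hlt t ht)
    rw [closure_Ico hT0.ne]
    exact Set.right_mem_Icc.2 hT0.le
  refine ⟨T, hTB.1, fun t ht ↦ ?_, ?_⟩
  · rcases ht.2.lt_or_eq with h | h
    · exact hKmem _ (hAK (hlt t ⟨ht.1, h⟩))
    · rw [h]; exact hKmem _ hTK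
  · refine le_antisymm (hKmem _ hTK).2 (not_lt.1 fun h ↦ hTB.2 ?_)
    exact (hAmem _).2 ⟨(hKmem _ hTK).1, h⟩

end Lengths

/-! ### The squared distance to a submanifold in a chart -/

section Metric
variable {E : Type*} [NormedAddCommGroup E] [NormedSpace ℝ E] [FiniteDimensional ℝ E]

/-- A metric defined near the origin agrees near the origin with a metric defined everywhere. -/
lemma exists_isMetricField_eqOn_ball {G : E → E →L[ℝ] E →L[ℝ] ℝ} {U : Set E} (hU : IsOpen U)
    (h0 : (0 : E) ∈ U) (hG : ContDiffOn ℝ ∞ G U) (hsymm : ∀ x v w, G x v w = G x w v)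
    (hpos : ∀ x ∈ U, ∀ v, v ≠ 0 → 0 < G x v v) :
    ∃ G' : E → E →L[ℝ] E →L[ℝ] ℝ, IsMetricField G' ∧ ∀ᶠ x in 𝓝 0, G' x = G x := by
  obtain ⟨R, hR, hRU⟩ := Metric.nhds_basis_closedBall.mem_iff.1 (hU.mem_nhds h0)
  let b : ContDiffBump (0 : E) := ⟨R / 2, R, by positivity, by linarith⟩
  refine ⟨fun x ↦ b x • G x + (1 - b x) • G 0, ⟨?_, fun x v w ↦ ?_, fun x v hv ↦ ?_⟩, ?_⟩
  · rw [contDiff_iff_contDiffAt]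
    intro x
    by_cases hx : x ∈ U
    · have h1 : ContDiffAt ℝ ∞ G x := hG.contDiffAt (hU.mem_nhds hx)
      exact (b.contDiffAt.smul h1).add ((contDiffAt_const.sub b.contDiffAt).smul contDiffAt_const)
    · have hx' : x ∈ (Metric.closedBall (0 : E) R)ᶜ := fun h ↦ hx (hRU h)
      refine (contDiffAt_const (c := G 0)).congr_of_eventuallyEq ?_
      filter_upwards [Metric.isClosed_closedBall.isOpen_compl.mem_nhds hx'] with y hy
      have : b y = 0 := b.zero_of_le_dist (by
        simp only [Set.mem_compl_iff, Metric.mem_closedBall, not_le] at hy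
        exact hy.le)
      simp [this]
  · simp [hsymm x v w, hsymm 0 v w]
  · have hb0 := b.nonneg' x
    have hb1 : b x ≤ 1 := b.le_one
    have h2 := hpos 0 h0 v hv
    simp only [add_apply, smul_apply, smul_eq_mul]
    by_cases hb : b x = 0
    · simpa [hb] using h2
    · have hx : x ∈ U := by
        by_contra hx
        refine hb (b.zero_of_le_dist (not_lt.1 fun h ↦ hx (hRU ?_)))
        exact Metric.mem_closedBall.2 h.le
      have h1 := hpos x hx v hv
      have h3 : 0 < b x := lt_of_le_of_ne hb0 (Ne.symm hb)
      have h4 : 0 ≤ (1 - b x) * G 0 v v := mul_nonneg (by linarith) h2.le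
      have := mul_pos h3 h1
      linarith
  · filter_upwards [Metric.closedBall_mem_nhds (0 : E) (half_pos hR)] with x hx
    have : b x = 1 := b.one_of_mem_closedBall hx
    simp [this]

lemma IsMetricField.norm_sq_le {G : E → E →L[ℝ] E →L[ℝ] ℝ} (hG : IsMetricField G) (x v : E) :
    ‖v‖ ^ 2 ≤ ‖cometric G x‖ ^ 2 * ‖G x‖ * G x v v := by
  have h0 := hG.self_nonneg x v
  have h1 : ‖G x v‖ ≤ √(‖G x‖ * G x v v) := by
    refine ContinuousLinearMap.opNorm_le_bound _ (Real.sqrt_nonneg _) fun w ↦ ?_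
    rw [Real.norm_eq_abs]
    refine abs_le_of_sq_le_sq ?_ (by positivity)
    rw [mul_pow, Real.sq_sqrt (by positivity)]
    refine (hG.sq_apply_le x v w).trans ?_
    have h2 : G x w w ≤ ‖G x‖ * ‖w‖ * ‖w‖ := (le_abs_self _).trans ((G x).le_opNorm₂ w w)
    calc G x v v * G x w w ≤ G x v v * (‖G x‖ * ‖w‖ * ‖w‖) := by gcongr
      _ = _ := by ring
  have h3 : ‖v‖ ≤ ‖cometric G x‖ * √(‖G x‖ * G x v v) := by
    conv_lhs => rw [← hG.cometric_apply x v]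
    exact ((cometric G x).le_opNorm _).trans (by gcongr)
  calc ‖v‖ ^ 2 ≤ (‖cometric G x‖ * √(‖G x‖ * G x v v)) ^ 2 := by gcongr
    _ = _ := by rw [mul_pow, Real.sq_sqrt (by positivity)]; ring

/-- Near a given point, a metric is bounded below by a multiple of the norm. -/
lemma IsMetricField.exists_mul_norm_le {G : E → E →L[ℝ] E →L[ℝ] ℝ} (hG : IsMetricField G) (x : E) :
    ∃ c > 0, ∀ᶠ y in 𝓝 x, ∀ v, c * ‖v‖ ≤ √(G y v v) := by
  set K := ‖cometric G x‖ ^ 2 * ‖G x‖ + 1 with hK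
  have hKpos : 0 < K := by positivity
  have hc : Continuous (fun y ↦ ‖cometric G y‖ ^ 2 * ‖G y‖) :=
    (hG.contDiff_cometric.continuous.norm.pow 2).mul hG.contDiff.continuous.norm
  have hev : ∀ᶠ y in 𝓝 x, ‖cometric G y‖ ^ 2 * ‖G y‖ < K :=
    hc.continuousAt.eventually_lt_const (by linarith)
  refine ⟨(√K)⁻¹, by positivity, hev.mono fun y hy v ↦ ?_⟩
  refine Real.le_sqrt_of_sq_le ?_
  rw [mul_pow, inv_pow, Real.sq_sqrt hKpos.le, inv_mul_le_iff₀ hKpos]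
  exact (hG.norm_sq_le y v).trans (by gcongr; exact hG.self_nonneg y v)

end Metric

section SquaredDistance
variable {n : ℕ} {X : Type*} [TopologicalSpace X] [T2Space X] [ChartedSpace (Cn n) X]
  [IsManifold 𝓘(ℂ, Cn n) ω X]

/-- A solution of the eikonal inequality on a ball, which vanishes on `V`, bounds from below the
squared distance to `V`, close to the center of the ball. -/
lemma HermitianMetric.sqrt_le_riemDist (g : HermitianMetric n X)
    {z : OpenPartialHomeomorph X (Cn n)} (hz : z ∈ IsManifold.maximalAtlas 𝓘(ℂ, Cn n) ω X)
    {V : Set X} {f : Cn n → ℝ} {R R' c : ℝ} (hRR' : R < R') (hR' : Metric.ball 0 R' ⊆ z.target)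
    (hf0 : ∀ ξ, 0 ≤ f ξ) (hf : ContDiffOn ℝ 1 f (Metric.ball 0 R'))
    (heik : ∀ ξ ∈ Metric.ball (0 : Cn n) R', ∀ v,
      (fderiv ℝ f ξ v) ^ 2 ≤ 4 * (f ξ * g.inChart z ξ v v))
    (hfV : ∀ x ∈ z.source, x ∈ V → ‖z x‖ < R' → f (z x) = 0)
    (hc0 : 0 ≤ c) (hc : ∀ ξ ∈ Metric.ball (0 : Cn n) R', ∀ v, c * ‖v‖ ≤ √(g.inChart z ξ v v))
    {ξ : Cn n} (hξ : ‖ξ‖ < R / 2) (hfξ : √(f ξ) ≤ c * (R / 2)) {y : X} (hy : y ∈ V) :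
    ENNReal.ofReal (√(f ξ)) ≤ g.riemDist (z.symm ξ) y := by
  have hR : 0 < R := by linarith [norm_nonneg ξ]
  refine le_of_forall_gt fun r hr ↦ ?_
  obtain ⟨γ, h0, h1, hγ, hlen⟩ := g.exists_path_of_riemDist_lt hr
  refine lt_of_le_of_lt ?_ hlen
  have hξt : ξ ∈ z.target := hR' (by simpa using by linarith)
  have hzγ0 : z (γ 0) = ξ := by rw [h0, z.right_inv hξt]
  rcases exists_exit_time z ((Metric.closedBall_subset_ball hRR').trans hR') hγ.continuousOn
    (by rw [h0]; exact z.map_target hξt) (by rw [hzγ0]; linarith) with hstay | ⟨T, hT, hle, hTR⟩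
  · -- the path stays in the ball: compare with the regularization `√(f + ε²)` of `√f`
    refine ENNReal.le_of_forall_pos_le_add fun ε hε _ ↦ ?_
    have hε' : (0 : ℝ) < ε := hε
    set φ : Cn n → ℝ := fun ξ ↦ √(f ξ + (ε : ℝ) ^ 2) with hφ
    have hpos : ∀ ξ, 0 < f ξ + (ε : ℝ) ^ 2 := fun ξ ↦ by have := hf0 ξ; positivity
    have hφC : ContDiffOn ℝ 1 φ (Metric.ball 0 R') :=
      (hf.add contDiffOn_const).sqrt fun ξ _ ↦ (hpos ξ).ne'
    have hφ' : ∀ ξ ∈ Metric.ball (0 : Cn n) R', ∀ v,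
        |fderiv ℝ φ ξ v| ≤ √(g.inChart z ξ v v) := by
      intro ξ hξ v
      have hd : HasFDerivAt f (fderiv ℝ f ξ) ξ :=
        ((hf.contDiffAt (Metric.isOpen_ball.mem_nhds hξ)).differentiableAt
          one_ne_zero).hasFDerivAt
      have hd2 := (hd.add_const ((ε : ℝ) ^ 2)).sqrt (hpos ξ).ne'
      rw [hd2.fderiv, smul_apply, smul_eq_mul, ← Real.sqrt_sq_eq_abs]
      refine Real.sqrt_le_sqrt ?_
      rw [mul_pow, div_pow, mul_pow, Real.sq_sqrt (hpos ξ).le, one_pow, div_mul_eq_mul_div,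
        one_mul, div_le_iff₀ (by have := hpos ξ; positivity)]
      have h2 := heik ξ hξ v
      have h3 : 0 ≤ g.inChart z ξ v v := by
        by_cases hv : v = 0
        · simp [hv]
        · exact (g.inChart_pos hz (hR' hξ) hv).le
      have h4 : 0 ≤ (ε : ℝ) ^ 2 * g.inChart z ξ v v := by positivity
      linarith
    have key := g.ofReal_abs_sub_le_length hz Metric.isOpen_ball hφC hφ' hγ
      (Set.right_mem_Icc.2 zero_le_one) (fun t ht ↦ ⟨(hstay t ht).1, by
        simpa using (hstay t ht).2.trans hRR'⟩)
    have hend := hstay 1 (Set.right_mem_Icc.2 zero_le_one)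
    have hfy : f (z (γ 1)) = 0 :=
      hfV _ hend.1 (by rw [h1]; exact hy) (hend.2.trans hRR')
    have hφy : φ (z (γ 1)) = ε := by simp [hφ, hfy]
    have hφξ : √(f ξ) ≤ φ ξ := Real.sqrt_le_sqrt (by simp)
    rw [hzγ0, hφy] at key
    calc ENNReal.ofReal (√(f ξ)) ≤ ENNReal.ofReal (|(ε : ℝ) - φ ξ| + ε) := by
          refine ENNReal.ofReal_le_ofReal ?_
          have := neg_abs_le ((ε : ℝ) - φ ξ)
          linarith
      _ = ENNReal.ofReal |(ε : ℝ) - φ ξ| + ε := by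
          rw [ENNReal.ofReal_add (abs_nonneg _) hε'.le, ENNReal.ofReal_coe_nnreal]
      _ ≤ _ := by gcongr
  · -- the path leaves the ball: compare with a linear form
    obtain ⟨ℓ, hℓ, hℓv⟩ := exists_dual_vector'' ℝ (z (γ T) - ξ)
    have hφ' : ∀ η ∈ Metric.ball (0 : Cn n) R', ∀ v,
        |fderiv ℝ (c • ℓ : Cn n →L[ℝ] ℝ) η v| ≤ √(g.inChart z η v v) := by
      intro η hη v
      rw [ContinuousLinearMap.fderiv, smul_apply, smul_eq_mul, abs_mul, abs_of_nonneg hc0]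
      refine le_trans ?_ (hc η hη v)
      gcongr
      exact (ℓ.le_opNorm v).trans (mul_le_of_le_one_left (norm_nonneg _) hℓ)
    have key := g.ofReal_abs_sub_le_length hz Metric.isOpen_ball
      (c • ℓ : Cn n →L[ℝ] ℝ).contDiff.contDiffOn hφ' hγ hT
      (fun t ht ↦ ⟨(hle t ht).1, by simpa using (hle t ht).2.trans_lt hRR'⟩)
    refine le_trans (ENNReal.ofReal_le_ofReal ?_) key
    rw [hzγ0, ← map_sub, smul_apply, hℓv, smul_eq_mul]
    refine hfξ.trans (le_trans ?_ (le_abs_self _))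
    have h5 : R / 2 ≤ ‖z (γ T) - ξ‖ := by
      have := norm_sub_norm_le (z (γ T)) ξ
      linarith
    exact mul_le_mul_of_nonneg_left h5 hc0

/-- In a chart in which `V` is a linear subspace, the squared distance to `V` has near the origin a
`C¹` derivative, and its second derivative at the origin is twice the metric on the normal
components. -/
theorem HermitianMetric.exists_hasFDerivAt_sqDist (g : HermitianMetric n X)
    {z : OpenPartialHomeomorph X (Cn n)} (hz : z ∈ IsManifold.maximalAtlas 𝓘(ℂ, Cn n) ω X)
    (hz0 : 0 ∈ z.target) {V : Set X} (P : Cn n →L[ℝ] Cn n) (hP : ∀ v, P (P v) = P v)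
    (hsym : ∀ v w, g.inChart z 0 (P v) w = g.inChart z 0 v (P w))
    (hV : ∀ x ∈ z.source, x ∈ V ↔ P (z x) = 0) :
    ∃ p : Cn n → Cn n →L[ℝ] ℝ, ContDiffAt ℝ 1 p 0 ∧
      (∀ v, fderiv ℝ p 0 v = g.inChart z 0 (P v)) ∧
      ∀ᶠ ξ in 𝓝 0, HasFDerivAt (fun ξ ↦ g.sqDist V (z.symm ξ)) ((2 : ℝ) • p ξ) ξ := by
  obtain ⟨G, hG, hGeq⟩ := exists_isMetricField_eqOn_ball z.open_target hz0
    (g.contDiffOn_inChart hz) (g.inChart_symm z) (fun x hx v hv ↦ g.inChart_pos hz hx hv)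
  have hG0 : G 0 = g.inChart z 0 := hGeq.self_of_nhds
  obtain ⟨f, p, hf00, hf0, hp, hfp, hpD, heik, hfP, hgeo⟩ :=
    exists_sqDist_potential hG P hP (by rwa [hG0])
  obtain ⟨c, hc0, hc⟩ := hG.exists_mul_norm_le 0
  refine ⟨p, hp, by rwa [hG0] at hpD, ?_⟩
  have hfC : ∀ᶠ ξ in 𝓝 0, ContDiffAt ℝ 1 f ξ := by
    have h1 : ContDiffAt ℝ 1 f 0 := by
      obtain ⟨u, hu, hpu⟩ := (hp.eventually (by simp)).and hfp |>.exists_mem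
      refine contDiffAt_one_iff.2 ⟨fun ξ ↦ (2 : ℝ) • p ξ, u, hu, ?_, fun ξ hξ ↦ (hpu ξ hξ).2⟩
      exact fun ξ hξ ↦ ((hpu ξ hξ).1.continuousAt.const_smul (2 : ℝ)).continuousWithinAt
    exact h1.eventually (by simp)
  obtain ⟨R', hR', hball⟩ := Metric.eventually_nhds_iff_ball.1
    (Filter.Eventually.and (p := fun ξ ↦ ξ ∈ z.target) (z.open_target.mem_nhds hz0)
      (hGeq.and (hfp.and (heik.and (hfP.and (hc.and hfC))))))
  have hR : 0 < R' / 2 := half_pos hR'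
  have hfcont : ContinuousAt (fun ξ ↦ √(f ξ)) 0 :=
    (hfp.self_of_nhds.continuousAt).sqrt
  have hsmall : ∀ᶠ ξ in 𝓝 0, √(f ξ) < c * (R' / 2 / 2) :=
    hfcont.eventually_lt_const (by simp only [hf00, Real.sqrt_zero]; positivity)
  have hmain : ∀ᶠ ξ in 𝓝 0, g.sqDist V (z.symm ξ) = f ξ := by
    filter_upwards [hsmall, hgeo R' hR', Metric.ball_mem_nhds (0 : Cn n) (half_pos hR)]
      with ξ h1 ⟨γ, hγC, hγ0, hγ1, hγ⟩ h3
    have hinf : ⨅ y ∈ V, g.riemDist (z.symm ξ) y = ENNReal.ofReal (√(f ξ)) := by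
      refine le_antisymm ?_ (le_iInf₂ fun y hy ↦ ?_)
      · have hmem : ∀ t ∈ Set.Icc (0 : ℝ) 1, γ t ∈ Metric.ball (0 : Cn n) R' :=
          fun t ht ↦ by simpa using (hγ t ht).1
        have h0t : γ 0 ∈ z.target :=
          (hball _ (hmem 0 (Set.left_mem_Icc.2 zero_le_one))).1
        refine (iInf₂_le (z.symm (γ 0)) ?_).trans ?_
        · rw [hV _ (z.map_target h0t), z.right_inv h0t, hγ0]
        · rw [← hγ1]
          refine g.riemDist_le_of_inChart hz hγC fun t ht ↦ ⟨(hball _ (hmem t ht)).1, ?_⟩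
          rw [← (hball _ (hmem t ht)).2.1, (hγ t ht).2, hγ1]
      · refine g.sqrt_le_riemDist hz (by linarith : R' / 2 < R') (fun ξ hξ ↦ (hball ξ hξ).1) hf0
          (fun ξ hξ ↦ (hball ξ hξ).2.2.2.2.2.2.contDiffWithinAt) ?_ ?_ hc0.le ?_
          (by simpa using h3) h1.le hy
        · intro ξ hξ v
          obtain ⟨-, h4, h5, h6, -⟩ := hball ξ hξ
          rw [h5.fderiv, ← h4, smul_apply, smul_eq_mul, mul_pow]
          have := h6 v
          linarith
        · intro x hx hxV hxR
          exact (hball (z x) (by simpa using hxR)).2.2.2.2.1 ((hV x hx).1 hxV)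
        · intro ξ hξ v
          rw [← (hball ξ hξ).2.1]
          exact (hball ξ hξ).2.2.2.2.2.1 v
    rw [HermitianMetric.sqDist, hinf, ENNReal.toReal_ofReal (Real.sqrt_nonneg _),
      Real.sq_sqrt (hf0 ξ)]
  filter_upwards [hfp, hmain.eventually_nhds] with ξ h1 h2
  exact h1.congr_of_eventuallyEq h2

end SquaredDistance

/-! ### Unitary normalization of the coordinates and the complex Hessian -/

section HermitianForms
variable {E : Type*} [AddCommGroup E] [Module ℂ E]

/-- The Hermitian inner product with real part `B / 2`, for a positive definite symmetric real
bilinear form `B` which is invariant under the multiplication by `i`. -/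
abbrev hermitianCore (B : E → E → ℝ) (hadd : ∀ u v w, B (u + v) w = B u w + B v w)
    (hsmul : ∀ (a : ℝ) v w, B ((a : ℂ) • v) w = a * B v w) (hsymm : ∀ v w, B v w = B w v)
    (hpos : ∀ v, v ≠ 0 → 0 < B v v)
    (hJ : ∀ v w, B (Complex.I • v) (Complex.I • w) = B v w) : InnerProductSpace.Core ℂ E where
  inner v w := (1 / 2) * (B v w - Complex.I * B v (Complex.I • w))
  conj_inner_symm v w := by
    have h1 : B w (Complex.I • v) = -B v (Complex.I • w) := by
      rw [← hJ, smul_smul, Complex.I_mul_I, hsymm,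
        show (-1 : ℂ) = ((-1 : ℝ) : ℂ) by simp, hsmul]
      ring
    simp [h1, hsymm w v, Complex.conj_ofNat, sub_eq_add_neg]
  re_inner_nonneg v := by
    by_cases hv : v = 0
    · have h0 : ∀ w, B 0 w = 0 := fun w ↦ by simpa using hsmul 0 0 w
      simp [hv, h0]
    · simpa using (hpos v hv).le
  add_left u v w := by simp only [hadd]; push_cast; ring
  smul_left v w r := by
    have h1 : ∀ v w, B (Complex.I • v) w = -B v (Complex.I • w) := fun v w ↦ by
      rw [hsymm v, ← hJ (Complex.I • w) v, smul_smul, Complex.I_mul_I,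
        show (-1 : ℂ) = ((-1 : ℝ) : ℂ) by simp, hsmul, hsymm w]
      ring
    have h2 : ∀ w, B (r • v) w = r.re * B v w - r.im * B v (Complex.I • w) := fun w ↦ by
      conv_lhs => rw [← Complex.re_add_im r]
      rw [add_smul, mul_smul, hadd, hsmul, hsmul, h1]
      ring
    have h3 : B v (Complex.I • Complex.I • w) = -B v w := by
      rw [smul_smul, Complex.I_mul_I, show (-1 : ℂ) = ((-1 : ℝ) : ℂ) by simp, hsymm, hsmul,
        hsymm w]
      ring
    have h4 : conj r = r.re - r.im * Complex.I := by
      apply Complex.ext <;> simp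
    rw [h2, h2, h3, h4]
    push_cast
    linear_combination (-(1 / 2) * (r.im : ℂ) * B v (Complex.I • w)) * Complex.I_sq
  definite v hv := by
    by_contra h
    have h1 := congrArg Complex.re hv
    have h2 := hpos v h
    simp at h1
    linarith

/-- Gram-Schmidt orthonormalization of a basis. The coordinates in the orthonormal basis are
orthonormal coordinates, and the change of basis is upper triangular. -/
lemma exists_basis_triangular_orthonormal {n : ℕ} (cd : InnerProductSpace.Core ℂ E)
    (f : Module.Basis (Fin n) ℂ E) :
    ∃ u : Module.Basis (Fin n) ℂ E,
      (∀ v w, cd.inner v w = ∑ i, conj (u.repr v i) * u.repr w i) ∧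
        ∀ i j, j < i → u.repr (f j) i = 0 := by
  let : NormedAddCommGroup E := cd.toNormedAddCommGroup
  let : InnerProductSpace ℂ E := InnerProductSpace.ofCore cd.toCore
  have : FiniteDimensional ℂ E := f.finiteDimensional_of_finite
  have hd : Module.finrank ℂ E = Fintype.card (Fin n) := Module.finrank_eq_card_basis f
  set u := InnerProductSpace.gramSchmidtOrthonormalBasis hd f with hu
  refine ⟨u.toBasis, fun v w ↦ ?_, fun i j hij ↦ ?_⟩
  · have h := u.sum_inner_mul_inner v w
    change inner ℂ v w = _
    rw [← h]
    refine Finset.sum_congr rfl fun i _ ↦ ?_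
    simp [OrthonormalBasis.repr_apply_apply]
  · have := InnerProductSpace.gramSchmidtOrthonormalBasis_inv_triangular' hd f hij
    simpa using this

end HermitianForms

section Normalization
variable {n : ℕ}

/-- A positive definite `J`-invariant bilinear form on `ℂⁿ` becomes twice the standard one after
a complex linear change of coordinates, which may be chosen to preserve the coordinate plane
`{v | v i = 0 for i ≥ k}`. -/
lemma exists_linear_normalization (B : Cn n →L[ℝ] Cn n →L[ℝ] ℝ) (hsymm : ∀ v w, B v w = B w v)
    (hpos : ∀ v, v ≠ 0 → 0 < B v v)
    (hJ : ∀ v w, B (Complex.I • v) (Complex.I • w) = B v w) (k : ℕ) :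
    ∃ A : Cn n ≃L[ℂ] Cn n, (∀ v w, B v w = 2 * ∑ i, (A v i * conj (A w i)).re) ∧
      ∀ v, (∀ i : Fin n, k ≤ (i : ℕ) → A v i = 0) ↔ ∀ i : Fin n, k ≤ (i : ℕ) → v i = 0 := by
  have hreal : ∀ (a : ℝ) (v : Cn n), (a : ℂ) • v = a • v := fun a v ↦ by
    ext i; simp
  set cd := hermitianCore (fun v w ↦ B v w) (fun u v w ↦ by simp)
    (fun a v w ↦ by rw [hreal]; simp) hsymm hpos hJ with hcd
  set f : Module.Basis (Fin n) ℂ (Cn n) := (EuclideanSpace.basisFun (Fin n) ℂ).toBasis with hf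
  obtain ⟨u, hu, hut⟩ := exists_basis_triangular_orthonormal cd f
  set A : Cn n ≃ₗ[ℂ] Cn n := u.equivFun.trans (WithLp.linearEquiv 2 ℂ (Fin n → ℂ)).symm with hA
  have hAapp : ∀ v i, A v i = u.repr v i := fun v i ↦ rfl
  refine ⟨A.toContinuousLinearEquiv, fun v w ↦ ?_, ?_⟩
  · have h1 := congrArg Complex.re (hu w v)
    have h2 : (cd.inner w v).re = (1 / 2) * B w v := by
      change ((1 / 2 : ℂ) * (B w v - Complex.I * B w (Complex.I • v))).re = _
      simp
    rw [h2, Complex.re_sum, hsymm] at h1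
    have h3 : B v w = 2 * ∑ i, (conj (u.repr w i) * u.repr v i).re := by linarith
    rw [h3]
    congr 1
    refine Finset.sum_congr rfl fun i _ ↦ ?_
    rw [mul_comm]
    rfl
  · set W : Submodule ℂ (Cn n) :=
      { carrier := {v | ∀ i : Fin n, k ≤ (i : ℕ) → v i = 0}
        add_mem' := fun {v w} hv hw i hi ↦ by simp [hv i hi, hw i hi]
        zero_mem' := fun i _ ↦ rfl
        smul_mem' := fun a v hv i hi ↦ by simp [hv i hi] } with hW
    have hWmem : ∀ v, v ∈ W ↔ ∀ i : Fin n, k ≤ (i : ℕ) → v i = 0 := fun v ↦ Iff.rfl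
    have hle : W.map (A : Cn n →ₗ[ℂ] Cn n) ≤ W := by
      rintro _ ⟨v, hv, rfl⟩ i hi
      change A v i = 0
      have hsum : v = ∑ j, v j • f j := by
        conv_lhs => rw [← f.sum_repr v]
        simp [hf]
      rw [hAapp, hsum, map_sum, Finsupp.finsetSum_apply]
      refine Finset.sum_eq_zero fun j _ ↦ ?_
      rw [map_smul, Finsupp.smul_apply]
      rcases lt_or_ge (j : ℕ) k with hj | hj
      · rw [hut i j (Fin.lt_def.2 (hj.trans_le hi)), smul_zero]
      · rw [(hWmem v).1 hv j hj, zero_smul]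
    have heq : W.map (A : Cn n →ₗ[ℂ] Cn n) = W :=
      Submodule.eq_of_le_of_finrank_eq hle (LinearEquiv.finrank_map_eq A W)
    intro v
    constructor
    · intro hv
      have h1 : A v ∈ W := hv
      rw [← heq] at h1
      obtain ⟨w, hw, hwv⟩ := h1
      rwa [← A.injective hwv]
    · intro hv
      exact hle ⟨v, hv, rfl⟩

/-- The real linear projection of `ℂⁿ` onto its coordinates with index at least `k`. -/
def normalProj (n k : ℕ) : Cn n →L[ℝ] Cn n :=
  LinearMap.toContinuousLinearMap
    { toFun := fun v ↦ WithLp.toLp 2 fun i ↦ if k ≤ (i : ℕ) then v i else 0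
      map_add' := fun v w ↦ by ext i; simp only [PiLp.add_apply]; split_ifs <;> simp
      map_smul' := fun a v ↦ by ext i; simp }

lemma normalProj_apply (k : ℕ) (v : Cn n) (i : Fin n) :
    normalProj n k v i = if k ≤ (i : ℕ) then v i else 0 := rfl

lemma normalProj_eq_zero_iff (k : ℕ) (v : Cn n) :
    normalProj n k v = 0 ↔ ∀ i : Fin n, k ≤ (i : ℕ) → v i = 0 := by
  constructor
  · intro h i hi
    have := congrArg (fun w : Cn n ↦ w i) h
    simpa [normalProj_apply, hi] using this
  · intro h
    ext i
    rw [normalProj_apply]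
    split_ifs with hi
    · exact h i hi
    · rfl

end Normalization

section ChangeOfChart
variable {n : ℕ} {X : Type*} [TopologicalSpace X] [ChartedSpace (Cn n) X]

/-- Composing a holomorphic chart with a complex affine change of coordinates gives a holomorphic
chart. -/
lemma transHomeomorph_mem_maximalAtlas {z : OpenPartialHomeomorph X (Cn n)}
    (hz : z ∈ IsManifold.maximalAtlas 𝓘(ℂ, Cn n) ω X) (T : Cn n ≃ₜ Cn n) (hT : ContDiff ℂ ω T)
    (hT' : ContDiff ℂ ω T.symm) :
    z.transHomeomorph T ∈ IsManifold.maximalAtlas 𝓘(ℂ, Cn n) ω X := by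
  have hTG : T.toOpenPartialHomeomorph ∈ contDiffGroupoid ω 𝓘(ℂ, Cn n) := by
    rw [contDiffGroupoid, mem_groupoid_of_pregroupoid]
    constructor
    · simpa [contDiffPregroupoid] using hT.contDiffOn
    · simpa [contDiffPregroupoid] using hT'.contDiffOn
  rw [IsManifold.maximalAtlas, mem_maximalAtlas_iff] at hz ⊢
  rw [OpenPartialHomeomorph.transHomeomorph_eq_trans]
  intro e he
  constructor
  · rw [OpenPartialHomeomorph.trans_symm_eq_symm_trans_symm, OpenPartialHomeomorph.trans_assoc]
    exact StructureGroupoid.trans _ (StructureGroupoid.symm _ hTG) (hz e he).1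
  · rw [← OpenPartialHomeomorph.trans_assoc]
    exact StructureGroupoid.trans _ (hz e he).2 hTG

/-- The real derivative of the inverse of a holomorphic chart is complex linear. -/
lemma exists_mfderiv_symm_eq {z : OpenPartialHomeomorph X (Cn n)}
    (hz : z ∈ IsManifold.maximalAtlas 𝓘(ℂ, Cn n) ω X) {ξ : Cn n} (hξ : ξ ∈ z.target) :
    ∃ L : Cn n →L[ℂ] Cn n,
      ∀ v : Cn n, mfderiv 𝓘(ℝ, Cn n) 𝓘(ℝ, Cn n) z.symm ξ v = L v := by
  have h1 : MDifferentiableAt 𝓘(ℂ, Cn n) 𝓘(ℂ, Cn n) z.symm ξ :=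
    (contMDiffAt_symm_of_mem_maximalAtlas hz hξ).mdifferentiableAt (by simp)
  let L : Cn n →L[ℂ] Cn n := mfderiv 𝓘(ℂ, Cn n) 𝓘(ℂ, Cn n) z.symm ξ
  have h2 : HasMFDerivAt 𝓘(ℂ, Cn n) 𝓘(ℂ, Cn n) z.symm ξ L := h1.hasMFDerivAt
  have h4 : HasFDerivWithinAt (writtenInExtChartAt 𝓘(ℂ, Cn n) 𝓘(ℂ, Cn n) ξ z.symm) L
    (Set.range 𝓘(ℂ, Cn n)) (extChartAt 𝓘(ℂ, Cn n) ξ ξ) := h2.2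
  have h3 : HasMFDerivAt 𝓘(ℝ, Cn n) 𝓘(ℝ, Cn n) z.symm ξ (L.restrictScalars ℝ) :=
    ⟨h2.1, h4.restrictScalars ℝ⟩
  exact ⟨L, fun w ↦ DFunLike.congr_fun h3.mfderiv w⟩

variable [IsManifold 𝓘(ℂ, Cn n) ω X]

/-- The expression of a Hermitian metric in a holomorphic chart is Hermitian. -/
lemma HermitianMetric.inChart_J (g : HermitianMetric n X) {z : OpenPartialHomeomorph X (Cn n)}
    (hz : z ∈ IsManifold.maximalAtlas 𝓘(ℂ, Cn n) ω X) {ξ : Cn n} (hξ : ξ ∈ z.target)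
    (v w : Cn n) :
    g.inChart z ξ (Complex.I • v) (Complex.I • w) = g.inChart z ξ v w := by
  have h : ∀ v w : Cn n, g.inChart z ξ v w = g.innerAt (z.symm ξ)
      (mfderiv 𝓘(ℝ, Cn n) 𝓘(ℝ, Cn n) z.symm ξ v)
      (mfderiv 𝓘(ℝ, Cn n) 𝓘(ℝ, Cn n) z.symm ξ w) := fun v w ↦ rfl
  obtain ⟨L, hL⟩ := exists_mfderiv_symm_eq hz hξ
  rw [h, h, hL, hL, hL, hL, map_smul, map_smul]
  exact g.inner_J (z.symm ξ) (L v) (L w)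

/-- The affine change of coordinates `ξ ↦ A (ξ - a)`. -/
def affineHomeo (A : Cn n ≃L[ℂ] Cn n) (a : Cn n) : Cn n ≃ₜ Cn n :=
  (Homeomorph.subRight a).trans A.toHomeomorph

lemma affineHomeo_symm_apply (A : Cn n ≃L[ℂ] Cn n) (a η : Cn n) :
    (affineHomeo A a).symm η = A.symm η + a := rfl

lemma HermitianMetric.inChart_affine (g : HermitianMetric n X)
    {z : OpenPartialHomeomorph X (Cn n)} (hz : z ∈ IsManifold.maximalAtlas 𝓘(ℂ, Cn n) ω X)
    (A : Cn n ≃L[ℂ] Cn n) {a : Cn n} (ha : a ∈ z.target) (v w : Cn n) :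
    g.inChart (z.transHomeomorph (affineHomeo A a)) 0 v w =
      g.inChart z a (A.symm v) (A.symm w) := by
  set T := affineHomeo A a with hT
  have hTa : T.symm 0 = a := by rw [affineHomeo_symm_apply, map_zero, zero_add]
  have hT' : HasFDerivAt T.symm ((A.symm : Cn n →L[ℂ] Cn n).restrictScalars ℝ) 0 :=
    ((A.symm : Cn n →L[ℂ] Cn n).restrictScalars ℝ).hasFDerivAt.add_const a
  have h1 : MDifferentiableAt 𝓘(ℝ, Cn n) 𝓘(ℝ, Cn n) z.symm (T.symm 0) := by
    rw [hTa]
    exact (contMDiffAt_symm_of_mem_maximalAtlas (mem_maximalAtlas_real hz) ha).mdifferentiableAt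
      (by simp)
  have h2 := h1.hasMFDerivAt.comp (0 : Cn n) hT'.hasMFDerivAt
  have h3 : ∀ v : Cn n, (mfderiv 𝓘(ℝ, Cn n) 𝓘(ℝ, Cn n) (z.transHomeomorph T).symm 0 v : Cn n) =
      mfderiv 𝓘(ℝ, Cn n) 𝓘(ℝ, Cn n) z.symm (T.symm 0) (A.symm v) := fun v ↦
    DFunLike.congr_fun h2.mfderiv v
  have h4 : ∀ (z : OpenPartialHomeomorph X (Cn n)) (ξ v w : Cn n), g.inChart z ξ v w =
      g.innerAt (z.symm ξ) (mfderiv 𝓘(ℝ, Cn n) 𝓘(ℝ, Cn n) z.symm ξ v)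
      (mfderiv 𝓘(ℝ, Cn n) 𝓘(ℝ, Cn n) z.symm ξ w) := fun z ξ v w ↦ rfl
  have h5 : (z.transHomeomorph T).symm 0 = z.symm a := by
    rw [← hTa]; rfl
  rw [h4, h4, h3, h3, h5, hTa]

end ChangeOfChart

section Hessian
variable {n : ℕ}

/-- The complex Hessian of a function with derivative `2 p`, where the derivative of `p` at the
origin is twice the standard scalar product on the coordinates with index at least `k`. -/
lemma complexHessian_eq {k : ℕ} {h : Cn n → ℝ} {p : Cn n → Cn n →L[ℝ] ℝ}
    (hp : DifferentiableAt ℝ p 0) (hh : ∀ᶠ ξ in 𝓝 0, HasFDerivAt h ((2 : ℝ) • p ξ) ξ)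
    (hpD : ∀ v w, fderiv ℝ p 0 v w = 2 * ∑ i, (normalProj n k v i * conj (w i)).re)
    (i j : Fin n) :
    complexHessian h 0 i j =
      if k ≤ (i : ℕ) ∧ k ≤ (j : ℕ) then (if i = j then 2 else 0) else 0 := by
  have hbar : wirtingerDBar j (fun w ↦ (h w : ℂ)) =ᶠ[𝓝 0] fun w ↦
      (p w (EuclideanSpace.single j 1) : ℂ) +
        Complex.I * (p w (EuclideanSpace.single j Complex.I) : ℂ) := by
    filter_upwards [hh] with w hw
    have h1 : HasFDerivAt (fun w ↦ (h w : ℂ)) (Complex.ofRealCLM.comp ((2 : ℝ) • p w)) w :=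
      Complex.ofRealCLM.hasFDerivAt_comp hw
    rw [wirtingerDBar, h1.fderiv]
    simp
    ring
  have hD : ∀ c : Cn n, HasFDerivAt (fun w ↦ (p w c : ℂ))
      (Complex.ofRealCLM.comp ((fderiv ℝ p 0).flip c)) 0 := fun c ↦
    Complex.ofRealCLM.hasFDerivAt_comp
      ((ContinuousLinearMap.apply ℝ ℝ c).hasFDerivAt_comp hp.hasFDerivAt)
  have hD2 := ((hD (EuclideanSpace.single j 1)).add
    ((hD (EuclideanSpace.single j Complex.I)).const_mul Complex.I)).congr_of_eventuallyEq hbar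
  have hval : ∀ v : Cn n, fderiv ℝ (wirtingerDBar j (fun w ↦ (h w : ℂ))) 0 v =
      if k ≤ (j : ℕ) then 2 * v j else 0 := by
    intro v
    have e1 : ∀ c : ℂ, fderiv ℝ p 0 v (EuclideanSpace.single j c) =
        2 * (normalProj n k v j * conj c).re := by
      intro c
      rw [hpD, Finset.sum_eq_single j]
      · simp
      · intro b _ hb
        simp [hb]
      · simp
    rw [hD2.fderiv]
    simp only [add_apply, smul_apply, ContinuousLinearMap.comp_apply,
      ContinuousLinearMap.flip_apply, e1, Complex.ofRealCLM_apply, normalProj_apply, smul_eq_mul]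
    split_ifs with hj
    · apply Complex.ext <;> simp
    · simp
  rw [complexHessian, wirtingerD, hval, hval]
  by_cases hj : k ≤ (j : ℕ)
  · by_cases hij : i = j
    · subst hij
      simp [hj]
      linear_combination (-1 : ℂ) * Complex.I_sq
    · simp [hj, hij, Ne.symm hij]
  · simp [hj]

end Hessian

end

theorem proposition2p1 (n k : ℕ) {X : Type*} [TopologicalSpace X] [T2Space X]
    [ChartedSpace (Cn n) X] [IsManifold 𝓘(ℂ, Cn n) ω X]
    (g : HermitianMetric n X) (V : Set X) (hV : IsComplexSubmanifold n k V)
    (p : X) (hp : p ∈ V) :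
    ∃ z ∈ IsManifold.maximalAtlas 𝓘(ℂ, Cn n) ω X,
      p ∈ z.source ∧ z p = 0 ∧ IsSliceChart k V z ∧
      ContDiffAt ℝ 2 (fun w : Cn n ↦ g.sqDist V (z.symm w)) 0 ∧
      ∀ i j : Fin n,
        complexHessian (fun w : Cn n ↦ g.sqDist V (z.symm w)) 0 i j =
          if k ≤ (i : ℕ) ∧ k ≤ (j : ℕ) then (if i = j then 2 else 0) else 0 := by
  obtain ⟨z₀, hz₀, hpz, hslice⟩ := hV.2 p hp
  set a := z₀ p with ha
  have hat : a ∈ z₀.target := z₀.map_source hpz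
  have haW : ∀ i : Fin n, k ≤ (i : ℕ) → a i = 0 := by
    have : p ∈ z₀.source ∩ V := ⟨hpz, hp⟩
    rw [IsSliceChart] at hslice
    rw [hslice] at this
    exact this.2
  obtain ⟨A, hAB, hAW⟩ := exists_linear_normalization (g.inChart z₀ a) (g.inChart_symm z₀ a)
    (fun v hv ↦ g.inChart_pos hz₀ hat hv) (g.inChart_J hz₀ hat) k
  set z := z₀.transHomeomorph (affineHomeo A a) with hzdef
  have hz : z ∈ IsManifold.maximalAtlas 𝓘(ℂ, Cn n) ω X :=
    transHomeomorph_mem_maximalAtlas hz₀ _ (A.contDiff.comp (contDiff_id.sub contDiff_const))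
      (A.symm.contDiff.add contDiff_const)
  have hzapp : ∀ x, z x = A (z₀ x - a) := fun x ↦ rfl
  have hzp : z p = 0 := by rw [hzapp, ← ha, sub_self, map_zero]
  have hV' : ∀ x ∈ z.source, x ∈ V ↔ ∀ i : Fin n, k ≤ (i : ℕ) → z x i = 0 := by
    intro x hx
    have hx₀ : x ∈ z₀.source := hx
    have h1 : x ∈ V ↔ ∀ i : Fin n, k ≤ (i : ℕ) → z₀ x i = 0 := by
      have h2 := Set.ext_iff.1 hslice x
      simpa [hx₀] using h2
    rw [h1, hzapp, hAW]
    refine forall₂_congr fun i hi ↦ ?_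
    rw [PiLp.sub_apply, haW i hi, sub_zero]
  have hG0 : ∀ v w, g.inChart z 0 v w = 2 * ∑ i, (v i * (starRingEnd ℂ) (w i)).re := by
    intro v w
    rw [g.inChart_affine hz₀ A hat, hAB]
    simp
  have h0t : (0 : Cn n) ∈ z.target := by
    rw [← hzp]
    exact z.map_source hpz
  obtain ⟨q, hq, hqD, hqh⟩ := g.exists_hasFDerivAt_sqDist hz h0t (V := V) (normalProj n k)
    (fun v ↦ by
      ext i
      simp only [normalProj_apply]
      split_ifs <;> rfl)
    (fun v w ↦ by
      rw [hG0, hG0]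
      congr 1
      refine Finset.sum_congr rfl fun i _ ↦ ?_
      rw [normalProj_apply, normalProj_apply]
      split_ifs <;> simp)
    (fun x hx ↦ by rw [hV' x hx, normalProj_eq_zero_iff])
  refine ⟨z, hz, hpz, hzp, ?_, ?_, ?_⟩
  · ext x
    simp only [Set.mem_inter_iff, Set.mem_ofPred_eq]
    exact and_congr_right fun hx ↦ hV' x hx
  · -- the derivative `2 q` is `C¹`, so the function is `C²`
    obtain ⟨u, hu, huD⟩ := hqh.exists_mem
    have := (contDiffAt_succ_iff_hasFDerivAt (𝕜 := ℝ) (n := 1)).2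
      ⟨fun ξ ↦ (2 : ℝ) • q ξ, ⟨u, hu, huD⟩, by exact_mod_cast hq.const_smul (2 : ℝ)⟩
    exact_mod_cast this
  · exact complexHessian_eq (hq.differentiableAt one_ne_zero) hqh
      (fun v w ↦ by rw [hqD, hG0])
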